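/- **Setting.** A Tanner graph is a finite bipartite graph $G=(L\cup R,E)$ without parallel edges, with variable nodes $L$ and check nodes $R$. It is left-regular with left degree $d_l$ if every variable node has degree $d_l$; its girth $g$ is the length of its shortest cycle. For $\mathcal S\subseteq L$ let $\Gamma(\mathcal S)$ be the set of check nodes adjacent to $\mathcal S$, and $G(\mathcal S)$ the subgraph induced on $\mathcal S\cup\Gamma(\mathcal S)$. A check node in $\Gamma(\mathcal S)$ is satisfied if its degree in $G(\mathcal S)$ is even, and unsatisfied if it is odd. $\mathcal S$ is an $(a,b)$ trapping set if $|\mathcal S|=a$ and it has exactly $b$ unsatisfied check nodes; it is elementary (an ETS) if all check nodes of $G(\mathcal S)$ have degree one or two; it is an absorbing set if each $v\in\mathcal S$ is adjacent to more satisfied than unsatisfied check nodes. $\mathcal T$ is the set of trapping sets $\mathcal S$ for which $G(\mathcal S)$ is connected (in particular $\mathcal S\ne\emptyset$) and every $v\in\mathcal S$ is adjacent to at least two satisfied check nodes. An ETS $\mathcal S\in\mathcal T$ is a layered superset (LSS) of an ETS $C\in\mathcal T$ if there is a nested sequence $C=\mathcal S^{(0)}\subset\mathcal S^{(1)}\subset\dots\subset\mathcal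 S^{(n)}=\mathcal S$, $n\ge 0$, of ETSs in $\mathcal T$ with $|\mathcal S^{(i)}|=|C|+i$ (the case $\mathcal S=C$ is allowed). $\mathcal S$ is LSS of a cycle if it is an LSS of the set of variable nodes of that cycle, and $\mathcal S$ is of type LSS$_x$ if $x$ is the least length of a cycle of the Tanner graph of which $\mathcal S$ is an LSS. Two ETSs have the same structure if their induced subgraphs are isomorphic. **Theorem.** Consider left-regular Tanner graphs with $d_l=4$ and $g=8$, and integers $0\le a\le 9$, $0\le b\le 8$. For every $x$, the number of non-isomorphic LSS$_x$ structures of $(a,b)$ ETSs in $\mathcal T$ (TS), and the number of those among them that are absorbing sets (AS), are as follows, where $x:n$ means that there are exactly $n$ structures of type LSS$_x$, and all numbers not listed are $0$. - $(8,0)$: TS $8:1$; AS $8:1$. - $(8,2)$: TS $8:1$; AS $8:1$. $(9,2)$: TS $8:2$; AS $8:1$. - $(7,4)$: TS $8:1$; AS $8:1$. $(8,4)$: TS $8:2$; AS $8:1$. $(9,4)$: TS $8:7$; AS $8:3$. - $(6,6)$: TS $8:1$; AS $8:1$. $(7,6)$: TS $8:1$; no AS. $(8,6)$: TS $8:5$;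 AS $8:2$. $(9,6)$: TS $8:18$, $10:1$; AS $8:5$. - $(4,8)$: TS $8:1$; no AS. $(5,8)$: TS $8:1$; no AS. $(6,8)$: TS $8:2$; no AS. $(7,8)$: TS $8:3$; no AS. $(8,8)$: TS $8:10$, $10:2$, $12:2$; AS $10:1$, $12:1$. $(9,8)$: TS $8:36$, $10:10$, $12:4$; AS $10:3$. Moreover, every $(a,b)$ ETS in $\mathcal T$ with $a\le 9$ and $b\le 8$ in such a graph is an LSS of one of its cycles. (In particular, the classes $(a,b)$ in this range that are not listed are empty.) -/

import Mathlib

namespace LDPC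

/-- A Tanner graph without parallel edges: `L` is the set of variable nodes, `R` the set of
check nodes, and `adj v c` says that the variable node `v` is joined to the check node `c`. -/
structure TannerGraph (L R : Type) where
  adj : L → R → Prop

namespace TannerGraph

variable {L R : Type} (G : TannerGraph L R)

/-- The underlying bipartite graph on `L ∪ R`. -/
def graph : SimpleGraph (L ⊕ R) where
  Adj
    | Sum.inl v, Sum.inr c => G.adj v c
    | Sum.inr c, Sum.inl v => G.adj v c
    | _, _ => False
  symm := ⟨by
    rintro (v | c) (w | d) h
    · exact h
    · exact h
    · exact h
    · exact h⟩
  loopless := ⟨by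
    rintro (v | c) h
    · exact h
    · exact h⟩

/-- Every variable node has degree `d`. -/
def LeftRegular (d : ℕ) : Prop := ∀ v : L, {c : R | G.adj v c}.ncard = d

/-- `Γ(S)`, the set of check nodes that have a neighbour in `S`. -/
def checks (S : Finset L) : Set R := {c | ∃ v ∈ S, G.adj v c}

/-- The vertex set `S ∪ Γ(S)`. -/
def nodes (S : Finset L) : Set (L ⊕ R) := Sum.inl '' (S : Set L) ∪ Sum.inr '' G.checks S

/-- The induced subgraph `G(S)` on `S ∪ Γ(S)`. -/
def inducedSubgraph (S : Finset L) : SimpleGraph (G.nodes S) := G.graph.induce (G.nodes S)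

/-- The degree in `G(S)` of a check node. -/
noncomputable def checkDegree (S : Finset L) (c : R) : ℕ := {v : L | v ∈ S ∧ G.adj v c}.ncard

/-- `Γ_o(S)`, the unsatisfied check nodes. -/
def unsatisfied (S : Finset L) : Set R := {c | c ∈ G.checks S ∧ Odd (G.checkDegree S c)}

/-- `Γ_e(S)`, the satisfied check nodes. -/
def satisfied (S : Finset L) : Set R := {c | c ∈ G.checks S ∧ Even (G.checkDegree S c)}

/-- `S` is an `(a, b)` trapping set. -/
def IsTrappingSet (S : Finset L) (a b : ℕ) : Prop :=
  S.card = a ∧ (G.unsatisfied S).ncard = b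

/-- All check nodes of `G(S)` have degree one or two. -/
def IsElementary (S : Finset L) : Prop :=
  ∀ c ∈ G.checks S, G.checkDegree S c = 1 ∨ G.checkDegree S c = 2

/-- Membership in `𝒯`: `G(S)` is connected, and every variable node of `S` is joined to at least
two satisfied check nodes. -/
def InT (S : Finset L) : Prop :=
  (G.inducedSubgraph S).Connected ∧
    ∀ v ∈ S, 2 ≤ {c : R | c ∈ G.satisfied S ∧ G.adj v c}.ncard

/-- `S` is an elementary trapping set belonging to `𝒯`. -/
def IsETS (S : Finset L) : Prop := G.IsElementary S ∧ G.InT S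

/-- Every variable node of `S` is joined to more satisfied than unsatisfied check nodes. -/
def IsAbsorbing (S : Finset L) : Prop :=
  ∀ v ∈ S, {c : R | c ∈ G.unsatisfied S ∧ G.adj v c}.ncard <
    {c : R | c ∈ G.satisfied S ∧ G.adj v c}.ncard

/-- `C` is the set of variable nodes of a cycle of length `x` of the Tanner graph. -/
def IsCycleSet (C : Finset L) (x : ℕ) : Prop :=
  ∃ (u : L ⊕ R) (w : G.graph.Walk u u), w.IsCycle ∧ w.length = x ∧
    ∀ v : L, v ∈ C ↔ Sum.inl v ∈ w.support

/-- `S` is a layered superset of `C`: there is a nested sequence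
`C = S⁽⁰⁾ ⊂ S⁽¹⁾ ⊂ ⋯ ⊂ S⁽ⁿ⁾ = S` of elementary trapping sets in `𝒯` whose sizes increase by one
at each step. The sequence may have length `n = 0`, that is, `S = C`. -/
def IsLSS (C S : Finset L) : Prop :=
  ∃ (n : ℕ) (T : ℕ → Finset L), T 0 = C ∧ T n = S ∧
    (∀ i < n, T i ⊆ T (i + 1)) ∧
    ∀ i ≤ n, (T i).card = C.card + i ∧ G.IsETS (T i)

/-- `S` is an `LSS_x` structure: `x` is the least length of a cycle of which `S` is a layered
superset. -/
def IsLSSType (S : Finset L) (x : ℕ) : Prop :=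
  IsLeast {y : ℕ | ∃ C : Finset L, G.IsCycleSet C y ∧ G.IsLSS C S} x

end TannerGraph

/-- An elementary trapping set in `𝒯`, in a finite Tanner graph of left degree `d` and girth `g`. -/
structure ETSIn (d g : ℕ) where
  L : Type
  R : Type
  finL : Finite L
  finR : Finite R
  G : TannerGraph L R
  leftRegular : G.LeftRegular d
  girth_eq : G.graph.girth = g
  S : Finset L
  isETS : G.IsETS S

/-- Two elementary trapping sets have the same structure if their induced subgraphs are
isomorphic. -/
instance ETSIn.setoid (d g : ℕ) : Setoid (ETSIn d g) where
  r s t := Nonempty (s.G.inducedSubgraph s.S ≃g t.G.inducedSubgraph t.S)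
  iseqv :=
    { refl := fun _ => ⟨SimpleGraph.Iso.refl⟩
      symm := fun ⟨e⟩ => ⟨e.symm⟩
      trans := fun ⟨e⟩ ⟨f⟩ => ⟨e.trans f⟩ }

/-- The non-isomorphic structures of elementary trapping sets in `𝒯`. -/
def ETSStructure (d g : ℕ) : Type 1 := Quotient (ETSIn.setoid d g)

/-- The structures of `(a, b)` elementary trapping sets in `𝒯` that are of type `LSS_x`. -/
def lssStructures (d g a b x : ℕ) : Set (ETSStructure d g) :=
  {q | ∃ s : ETSIn d g, Quotient.mk (ETSIn.setoid d g) s = q ∧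
    s.G.IsTrappingSet s.S a b ∧ s.G.IsLSSType s.S x}

/-- The structures among these that are absorbing sets. -/
def lssAbsorbingStructures (d g a b x : ℕ) : Set (ETSStructure d g) :=
  {q | ∃ s : ETSIn d g, Quotient.mk (ETSIn.setoid d g) s = q ∧
    s.G.IsTrappingSet s.S a b ∧ s.G.IsLSSType s.S x ∧ s.G.IsAbsorbing s.S}

/-- The number of `LSS_x` structures of `(a, b)` elementary trapping sets for left degree 4 and
girth 8, as a function of `a`, `b`, `x`. -/
def tableTS : ℕ → ℕ → ℕ → ℕ
  | 8, 0, 8 => 1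
  | 8, 2, 8 => 1
  | 9, 2, 8 => 2
  | 7, 4, 8 => 1
  | 8, 4, 8 => 2
  | 9, 4, 8 => 7
  | 6, 6, 8 => 1
  | 7, 6, 8 => 1
  | 8, 6, 8 => 5
  | 9, 6, 8 => 18
  | 9, 6, 10 => 1
  | 4, 8, 8 => 1
  | 5, 8, 8 => 1
  | 6, 8, 8 => 2
  | 7, 8, 8 => 3
  | 8, 8, 8 => 10
  | 8, 8, 10 => 2
  | 8, 8, 12 => 2
  | 9, 8, 8 => 36
  | 9, 8, 10 => 10
  | 9, 8, 12 => 4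
  | _, _, _ => 0

/-- The number of those structures that are absorbing sets. -/
def tableAS : ℕ → ℕ → ℕ → ℕ
  | 8, 0, 8 => 1
  | 8, 2, 8 => 1
  | 9, 2, 8 => 1
  | 7, 4, 8 => 1
  | 8, 4, 8 => 1
  | 9, 4, 8 => 3
  | 6, 6, 8 => 1
  | 8, 6, 8 => 2
  | 9, 6, 8 => 5
  | 8, 8, 10 => 1
  | 8, 8, 12 => 1
  | 9, 8, 10 => 3
  | _, _, _ => 0

end LDPC

/-! Join two variable nodes of an ETS `S` when they share a check node; this is the normal graph `H`
of `S`. As the Tanner graph has no 4-cycle, two nodes share at most one check; as it has no 6-cycle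
and `S` is elementary, `H` is triangle-free. The checks of degree two subdivide the edges of `H`,
and those of degree one hang as 4 - deg v leaves at each vertex v. So `G(S)` and `H` determine each
other up to isomorphism (`normalOn_iso_of_induced`, `induced_iso_of_normalOn`), and every notion of
the theorem becomes one about `H`: degrees lie between 2 and 4, b = 4a - 2|E(H)|, and `S` is
absorbing iff all degrees are at least 3. Cycles of length 2k through nodes of `S` correspond to
k-cycles of `H`, and `S` is an LSS of such a cycle iff all of `H` is reached from it by adding
vertices with two neighbours in the current set (`setOf_cycle_lss`).

It remains to classify triangle-free graphs with these degrees, a ≤ 9 vertices and at least 2a - 4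
edges. Deleting a vertex of minimal degree stays within the larger class of triangle-free graphs of
maximal degree at most 4 with at least `minEdges n` edges, so that class is built up one vertex at a
time (`exists_code`), and the kernel checks that explicit lists are closed under these extensions
(`codesClosed_eq_true`). The normal form used there is only a heuristic: it always returns an
isomorphic copy, which is all that completeness needs. An isomorphism-invariant hash that differs on
all final codes shows that they are pairwise non-isomorphic (`graphHash_nodup`), and each of them is
realized by a Tanner graph of girth 8 (`exists_etsIn`). `encard_structures` then turns each count of
structures into a count of codes, which `finalCodes_table` evaluates.

Connectedness is never tested: every final code has a nonzero `codeType`, hence grows from a cycle.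
The same fact gives the last assertion. -/

namespace LDPC

/-! ### Graphs on at most nine vertices, encoded by natural numbers -/

/-- Adjacency of the vertices `i` and `j` in the graph with code `c`. -/
def codeAdj (c i j : ℕ) : Bool := c / 2 ^ (9 * i + j) % 2 == 1

/-- The neighbours of `i` in the graph with code `c` on `n` vertices. -/
def codeNbrs (n c i : ℕ) : List ℕ := (List.range n).filter (codeAdj c i)

/-- The sum of the degrees. -/
def codeDegSum (n c : ℕ) : ℕ := ((List.range n).map fun i => (codeNbrs n c i).length).sum

/-- The code of the graph on `n` vertices with adjacency `r`. -/
def encode (n : ℕ) (r : ℕ → ℕ → Bool) : ℕ :=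
  ((List.range n).flatMap fun i => ((List.range n).filter (r i)).map fun j => 9 * i + j).foldr
    (fun k c => 2 ^ k ||| c) 0

/-- The graph obtained by joining a new vertex `n` to the vertices in `s`. -/
def extendCode (n c : ℕ) (s : List ℕ) : ℕ :=
  encode (n + 1) fun i j =>
    if i = n then s.elem j else if j = n then s.elem i else codeAdj c i j

/-! Colours of the vertices are stored in the digits of a number to the base `2 ^ 32`. -/

/-- The colour of the vertex `i`. -/
def colour (col i : ℕ) : ℕ := col / 2 ^ (32 * i) % 2 ^ 32

/-- One round of colour refinement; the masks `ms` select the neighbours of the vertices. -/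
def refineColours (col : ℕ) : List ℕ → ℕ → ℕ
  | [], _ => 0
  | m :: ms, rest =>
    -- As 2^32 is 1 modulo 2^32 - 1, the remainder of the masked number is the sum of the
    -- neighbours' colours.
    let x := 3 * (rest % 2 ^ 32) + (col &&& m) % (2 ^ 32 - 1)
    x * x % 65521 + 2 ^ 32 * refineColours col ms (rest / 2 ^ 32)

/-- Two rounds of colour refinement. -/
def refineTwice (ms : List ℕ) (col : ℕ) : ℕ :=
  let col' := refineColours col ms col
  refineColours col' ms col'

/-- An ordering of the vertices, found by colour refinement. -/
def greedyOrder (ms : List ℕ) : ℕ → ℕ → List ℕ → List ℕ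
  | 0, _, _ => []
  | _ + 1, _, [] => []
  | k + 1, col, a :: l =>
    let v := l.foldl (fun b i => if colour col b < colour col i then i else b) a
    -- Raising the colour of `v` individualises it before the next refinement.
    v :: greedyOrder ms k (refineTwice ms (col + 2 ^ (32 * v))) ((a :: l).erase v)

/-- The graph with code `c`, with the vertices reordered according to `p`. -/
def relabel (n c : ℕ) (p : List ℕ) : ℕ :=
  -- With this guard the result is isomorphic to the input for every list `p`, so nothing has to be
  -- proved about the heuristic that produces `p`.
  if p.length = n ∧ p.Nodup ∧ ∀ x ∈ p, x < n then
    encode n fun i j => codeAdj c (p.getD i 0) (p.getD j 0)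
  else c

/-- A reordering of the graph with code `c` that is the same for most isomorphic graphs. -/
def canonCode (n c : ℕ) : ℕ :=
  let ms := (List.range n).map fun i =>
    ((codeNbrs n c i).map fun j => (2 ^ 32 - 1) * 2 ^ (32 * j)).sum
  let uniform := ((List.range n).map fun j => 2 * 2 ^ (32 * j)).sum
  -- The initial colour of `u` is the sum of all colours after two rounds that start from 7 at `u`
  -- and 2 elsewhere.
  relabel n c (greedyOrder ms n ((List.range n).map fun u =>
    refineTwice ms (uniform + 5 * 2 ^ (32 * u)) % (2 ^ 32 - 1) % 65521 * 2 ^ (32 * u)).sum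
      (List.range n))

/-- The least number of edges of the graphs on `n` vertices in the enumeration. -/
def minEdges (n : ℕ) : ℕ := [0, 0, 1, 2, 3, 5, 7, 9, 11, 14].getD n 0

/-- The sets of at most four independent vertices of degree at most three. -/
def independentSets (n c : ℕ) : List ℕ → List (List ℕ)
  | [] => [[]]
  | a :: l =>
    let r := independentSets n c l
    if (codeNbrs n c a).length ≤ 3 then
      r ++ (r.filter fun s => decide (s.length ≤ 3) && s.all fun i => !codeAdj c a i).map (a :: ·)
    else r

/-- After joining a new vertex to `s`, the graph has at least `minEdges` edges and the new vertex
has minimal degree. -/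
def isExtension (n c : ℕ) (s : List ℕ) : Bool :=
  decide (2 * minEdges (n + 1) ≤ codeDegSum n c + 2 * s.length) &&
    (List.range n).all fun i =>
      decide (s.length ≤ (codeNbrs n c i).length + if s.elem i then 1 else 0)

/-- The lists are mere data: `codesClosed_eq_true` makes them exhaustive, and `finalCodes_table` and
`graphHash_nodup` certify the codes that are counted. -/
def codes : ℕ → List ℕ
  | 0 => [0]
  | 1 => [0]
  | 2 => [514]
  | 3 => [262662]
  | 4 => [134480398, 807669764, 807670278]
  | 5 => [413128733190, 690015971336, 826920143370]
  | 6 => [105760216346680, 212070599778316, 246772595191864, 422629492404236, 741760861481000,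
      847110230519832, 987434599055902]
  | 7 => [108297909770183182, 180496599763183636, 234575185842298976, 234645485875364466,
      397098041651544598, 450646261505466950, 469295833729253914, 541353427649741330,
      651687487439652888, 668855326553961026, 669137151297871952, 669631448485464650,
      759598306663377450, 794991516577450036, 1011273973631046162, 1083155439115844130]
  | 8 => [27868840410336569552, 28591247645189968076, 55448989867039903780, 64671937009230663856,
      65196925361605161168, 83172865389296378084, 92884842724056451602, 101655673789607422160,
      101764293777194567908, 101908374063831140544, 111511379426247213582,
      111691773754373861424, 120789220713069811904, 148042833014181642766,
      148459134629290730062, 166471421952290277444, 175859420006006755496,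
      203565528971607347734, 221523773386402312276, 221541717278586358298,
      231035556191787028708, 277242028566375399440, 313816313146997815308,
      323455281119172341976, 341866278014077639378, 350673102484256686630,
      351198301313961136208, 388109557936721569828, 397387078790948694224,
      406067661036180214370, 406628394926063505926, 443123043247430091290,
      461569752136902087222, 526513730470313494724, 526765865941835211458,
      526765936585738302146, 536007358136621566522, 592962933308478994456,
      648086777593541509642, 648104792060636250706, 648539459512365552210,
      658176566920571084976, 676551077626529729170, 694926080355363545264,
      749651859355258372260, 786473324956132878978, 796256830412351148614,
      823837298672861452420, 832482310074604800016, 851453793598385160284,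
      897338432576322812040, 906507656139121172588, 943526679729859276860,
      943545540962916048996, 961847958609003567208, 980348781339795849730,
      1035508519718644927002, 1035580507564038988302, 1053865121905134602826,
      1109205248240160612464]
  | 9 => [47298499072628840106546, 47362123989172938326160, 61511155107610764020192,
      61584869962243557605856, 62297200258321825739088, 70974118040599613645248,
      71130920079431615832400, 71186260416797859873136, 85529362645694099624646,
      99502120643716746586954, 108826981025354506015176, 109327259618652572520864,
      114381599626284518122126, 118253231993960271987650, 123040090023510621438542,
      123317355645367879403576, 127550499331007783797216, 127753413243153096083936,
      132716043843752691789960, 141699206113991680311440, 170337446552136355473524,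
      175023660358134305155850, 175106472543915858221520, 184412868942925496811800,
      193949189424551349768966, 194440328854795832308100, 198746317316436145872940,
      212562653939457031496016, 232449759890452498942276, 236803837608946806489682,
      241312017268953422463424, 255506207980660294389836, 264794542247418385166528,
      265119046901961563627624, 274027115243812790927930, 283858745636429853386864,
      316865350356058879236360, 317069627113349099448628, 335459375679237978788152,
      344895065562021641100194, 349783438905847822878924, 350421578952741765668968,
      387997883160955571359812, 401415745577136544588200, 416396120428114855883398,
      421118450988019211088802, 421404451800601237697318, 426126800409741555269752,
      435313781285870360617044, 458971579597551566853010, 463313499725702182875714,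
      473165953160297006015018, 482629529436957589307934, 482684742722252945363020,
      496897688890264300610434, 501629314843441218650654, 511018635970940430975020,
      528909883423297766955570, 567742463670723004664418, 612139458212660150309654,
      635601414813840669052976, 640916094785121010503992, 654241521357667718277288,
      654825007300848955066922, 668528637080749060760354, 688029421790397521987940,
      692493133347936927664212, 702178073929646900322918, 711613241775267323744408,
      720772804105981630181412, 739671131221377058681008, 758106537612789019939366,
      762717933109251894776598, 762773381498258055780628, 768023896434925330143376,
      772773426519498635522308, 777588569204368681029652, 805802792163498258991778,
      852488778791950593386724, 914243843808751933002546, 914299435859374548243222,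
      923375483854577568979244, 937699167653864367587484, 952042017164803675521842,
      956727418137115646902806, 984664755160008115129010, 984996927546976385895122,
      994367855592028420592262, 994441660017590242001092, 1003886393619261249561282,
      1003895598976347692149250, 1022729634462952914722900, 1060240676297751482409104,
      1065138394877857683327256, 1069814698933152180214498, 1079167017315551991136496,
      1079222592558954224816774, 1079222628658394601668740, 1079231437449115701201000,
      1135798449828382187294928]
  | _ => []

/-- The extensions of the graphs on `n` vertices are among the graphs on `n + 1` vertices. -/
def codesClosed (n : ℕ) : Bool :=
  (codes n).all fun c => ((independentSets n c (List.range n)).filter (isExtension n c)).all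
    fun s => (codes (n + 1)).elem (canonCode (n + 1) (extendCode n c s))

/-! ### Hashes, growth and cycle search on codes -/

/-- One round of colour refinement. -/
def refineStep (n c : ℕ) (col : List ℕ) : List ℕ :=
  (List.range n).map fun i =>
    (3 * col.getD i 0 + ((codeNbrs n c i).map fun j => col.getD j 0).sum) ^ 2 % 65521

/-- A hash of the graph with code `c` and the distinguished vertex `u`. -/
def vertexHash (n c u : ℕ) : ℕ :=
  (refineStep n c (refineStep n c ((List.range n).map fun i => if i = u then 7 else 2))).sum

/-- A hash of the graph with code `c`. -/
def graphHash (n c : ℕ) : ℕ := ((List.range n).map fun u => vertexHash n c u ^ 2 % 65521).sum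

/-- The vertex `i` belongs to the set with bit mask `A`. -/
def maskMem (A i : ℕ) : Bool := A / 2 ^ i % 2 == 1

/-- The least vertex outside `A` that has two neighbours in `A`. -/
def nextVertex (n c A : ℕ) : Option ℕ :=
  (List.range n).find? fun i =>
    !maskMem A i && decide (2 ≤ ((codeNbrs n c i).filter (maskMem A)).length)

/-- Adding vertices with two neighbours in the set leads from `A` to the set of all vertices. -/
def codeFills (n c : ℕ) : ℕ → ℕ → Bool
  | 0, A => (List.range n).all (maskMem A)
  | k + 1, A =>
    match nextVertex n c A with
    | some i => codeFills n c k (2 ^ i ||| A)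
    | none => (List.range n).all (maskMem A)

/-- There is a path with `k` further vertices from `v` that avoids `A` and ends in a neighbour of
`s`, such that `A` and the path fill the graph. -/
def codeCycleFrom (n c s : ℕ) : ℕ → ℕ → ℕ → Bool
  | 0, v, A => codeAdj c v s && codeFills n c n A
  | k + 1, v, A =>
    (codeNbrs n c v).any fun w => !maskMem A w && codeCycleFrom n c s k w (2 ^ w ||| A)

/-- There is a cycle of length `k + 1` that fills the graph. -/
def codeHasCycle (n c k : ℕ) : Bool :=
  (List.range n).any fun s => codeCycleFrom n c s k s (2 ^ s)

/-- Twice the least length of a cycle that fills the graph, if this length is `4`, `5` or `6`. -/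
def codeType (n c : ℕ) : ℕ :=
  if codeHasCycle n c 3 then 8 else if codeHasCycle n c 4 then 10 else
    if codeHasCycle n c 5 then 12 else 0

/-- The codes of the nonempty graphs with minimal degree at least two and at least `2n - 4`
edges. -/
def finalCodes (n : ℕ) : List ℕ :=
  (codes n).filter fun c => decide (0 < n) && (decide (4 * n ≤ codeDegSum n c + 8) &&
    (List.range n).all fun i => decide (2 ≤ (codeNbrs n c i).length))

/-- The code `c` describes a triangle-free graph of maximal degree at most four. -/
def codeValid (n c : ℕ) : Bool :=
  (List.range n).all fun i => !codeAdj c i i && (decide ((codeNbrs n c i).length ≤ 4) &&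
    (List.range n).all fun j => (codeAdj c i j == codeAdj c j i) &&
      (!codeAdj c i j || (codeNbrs n c j).all fun k => !codeAdj c i k))

/-- All degrees are at least three. -/
def codeAbsorbing (n c : ℕ) : Bool :=
  (List.range n).all fun i => decide (3 ≤ (codeNbrs n c i).length)

/-! ### Labellings of graphs by codes -/

/-- The bijection `e` identifies the graph with code `c` on `n` vertices with `H`. -/
def IsLabelling {V : Type} {n : ℕ} (c : ℕ) (H : SimpleGraph V) (e : Fin n ≃ V) : Prop :=
  ∀ i j : Fin n, H.Adj (e i) (e j) ↔ codeAdj c i j = true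

/-- The graph with code `c` on `n` vertices is isomorphic to `H`. -/
def Realizes {V : Type} (n c : ℕ) (H : SimpleGraph V) : Prop :=
  ∃ e : Fin n ≃ V, IsLabelling c H e

theorem codeAdj_eq_testBit (c i j : ℕ) : codeAdj c i j = c.testBit (9 * i + j) := by
  rw [Nat.testBit_eq_decide_div_mod_eq, codeAdj]
  rfl

theorem testBit_foldr (l : List ℕ) (k : ℕ) :
    (l.foldr (fun k c => 2 ^ k ||| c) 0).testBit k = decide (k ∈ l) := by
  induction l with
  | nil => simp
  | cons a l ih =>
    rw [List.foldr_cons, Nat.testBit_or, ih, Nat.testBit_two_pow, ← Bool.decide_or]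
    simp [eq_comm]

/-- For column indices below nine the bit position `9 * i + j` determines the pair; hence the bound
on `n`. -/
theorem codeAdj_encode {n : ℕ} (hn : n ≤ 9) (r : ℕ → ℕ → Bool) {i j : ℕ} (hi : i < n)
    (hj : j < n) : codeAdj (encode n r) i j = r i j := by
  rw [codeAdj_eq_testBit, encode, testBit_foldr, Bool.eq_iff_iff]
  simp only [List.mem_flatMap, List.mem_range, List.mem_map, List.mem_filter, decide_eq_true_eq]
  constructor
  · rintro ⟨i', hi', j', ⟨hj', h⟩, e⟩
    obtain rfl : i' = i := by omega
    obtain rfl : j' = j := by omega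
    exact h
  · exact fun h => ⟨i, hi, j, ⟨hj, h⟩, rfl⟩

theorem isLabelling_encode {V : Type} {H : SimpleGraph V} {n : ℕ} (hn : n ≤ 9) (e : Fin n ≃ V)
    (r : ℕ → ℕ → Bool) (h : ∀ i j : Fin n, H.Adj (e i) (e j) ↔ r i j = true) :
    IsLabelling (encode n r) H e := fun i j => by
  rw [codeAdj_encode hn r i.2 j.2, h]

/-- Either the guard holds and `p` is a permutation to compose the labelling with, or the code is
unchanged. -/
theorem Realizes.relabel {V : Type} {H : SimpleGraph V} {n c : ℕ} (hn : n ≤ 9)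
    (h : Realizes n c H) (p : List ℕ) : Realizes n (relabel n c p) H := by
  unfold LDPC.relabel
  split_ifs with hp
  · obtain ⟨hl, hnd, hlt⟩ := hp
    obtain ⟨e, he⟩ := h
    have hget : ∀ i : Fin n, p.getD i 0 = p[i.1]'(hl ▸ i.2) := fun i =>
      List.getD_eq_getElem _ _ _
    have hlt' : ∀ i : Fin n, p.getD i 0 < n := fun i => by
      rw [hget]; exact hlt _ (List.getElem_mem _)
    have hinj : Function.Injective fun i : Fin n => (⟨p.getD i 0, hlt' i⟩ : Fin n) := by
      intro i j hij
      have : p.getD i 0 = p.getD j 0 := congrArg Fin.val hij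
      rw [hget, hget] at this
      exact Fin.ext ((hnd.getElem_inj_iff).1 this)
    refine ⟨(Equiv.ofBijective _ (Finite.injective_iff_bijective.1 hinj)).trans e,
      isLabelling_encode hn _ _ fun i j => ?_⟩
    simp only [Equiv.trans_apply, Equiv.ofBijective_apply]
    exact he _ _
  · exact h

theorem Realizes.canonCode {V : Type} {H : SimpleGraph V} {n c : ℕ} (hn : n ≤ 9)
    (h : Realizes n c H) : Realizes n (canonCode n c) H := h.relabel hn _

theorem sum_map_range (n : ℕ) (f : ℕ → ℕ) : ((List.range n).map f).sum = ∑ i : Fin n, f i := by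
  induction n with
  | zero => simp
  | succ n ih => simp [List.range_succ, Fin.sum_univ_castSucc, ih]

theorem sum_map_filter (l : List ℕ) (p : ℕ → Bool) (f : ℕ → ℕ) :
    ((l.filter p).map f).sum = (l.map fun x => if p x then f x else 0).sum := by
  induction l with
  | nil => rfl
  | cons a l ih => by_cases h : p a <;> simp [h, ih]

section Labelling

variable {V : Type} {H : SimpleGraph V} {n c : ℕ} {e : Fin n ≃ V}

theorem IsLabelling.sum_nbrs [Fintype V] [DecidableRel H.Adj] (h : IsLabelling c H e) (i : Fin n)
    (f : ℕ → ℕ) (g : V → ℕ) (hfg : ∀ j, g (e j) = f j) :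
    ((codeNbrs n c i).map f).sum = ∑ w, if H.Adj (e i) w then g w else 0 := by
  rw [codeNbrs, sum_map_filter, sum_map_range, ← e.sum_comp]
  refine Finset.sum_congr rfl fun j _ => ?_
  simp only [h i j, hfg]

theorem IsLabelling.length_nbrs [Fintype V] [DecidableRel H.Adj] (h : IsLabelling c H e)
    (i : Fin n) : (codeNbrs n c i).length = H.degree (e i) := by
  have := h.sum_nbrs i (fun _ => 1) (fun _ => 1) fun _ => rfl
  simp only [List.map_const', List.sum_replicate, smul_eq_mul, mul_one] at this
  rw [this, Finset.sum_boole, ← H.card_neighborFinset_eq_degree, H.neighborFinset_eq_filter]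
  rfl

theorem IsLabelling.degSum [Fintype V] [DecidableRel H.Adj] (h : IsLabelling c H e) :
    codeDegSum n c = ∑ v, H.degree v := by
  rw [codeDegSum, sum_map_range, ← e.sum_comp]
  exact Finset.sum_congr rfl fun i _ => h.length_nbrs i

end Labelling

/-! ### Completeness of the enumeration -/

theorem mem_independentSets {n c : ℕ} {s l : List ℕ} (h : s.Sublist l) (h4 : s.length ≤ 4)
    (h3 : ∀ a ∈ s, (codeNbrs n c a).length ≤ 3)
    (hs : s.Pairwise fun a i => codeAdj c a i = false) : s ∈ independentSets n c l := by
  induction h with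
  | slnil => simp [independentSets]
  | @cons s l a h ih =>
    have := ih h4 h3 hs
    unfold independentSets
    dsimp only
    split_ifs
    · exact List.mem_append_left _ this
    · exact this
  | @cons_cons s l a h ih =>
    rw [List.length_cons] at h4
    rw [List.pairwise_cons] at hs
    have := ih (by omega) (fun b hb => h3 b (List.mem_cons_of_mem _ hb)) hs.2
    unfold independentSets
    dsimp only
    rw [if_pos (h3 a List.mem_cons_self)]
    refine List.mem_append_right _ (List.mem_map.2 ⟨s, List.mem_filter.2 ⟨this, ?_⟩, rfl⟩)
    simp only [Bool.and_eq_true, decide_eq_true_eq, List.all_eq_true, Bool.not_eq_true']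
    exact ⟨by omega, hs.1⟩

/-- A labelling of the graph without the vertex `v` extends to the whole graph. -/
theorem IsLabelling.extend {V : Type} {H : SimpleGraph V} {n c : ℕ} (hn : n + 1 ≤ 9) (v : V)
    {e : Fin n ≃ {w // w ≠ v}} (h : IsLabelling c (H.comap Subtype.val) e) {s : List ℕ}
    (hs : ∀ i : Fin n, (i : ℕ) ∈ s ↔ H.Adj v (e i)) (hsn : ∀ i ∈ s, i < n) :
    Realizes (n + 1) (extendCode n c s) H := by
  classical
  -- The last index goes to `none` and thus to `v`; the other indices keep their labels.
  refine ⟨finSuccEquivLast.trans ((Equiv.optionCongr e).trans (Equiv.optionSubtypeNe v)),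
    isLabelling_encode hn _ _ fun i j => ?_⟩
  have hlt : n ∉ s := fun h => lt_irrefl _ (hsn _ h)
  induction i using Fin.lastCases with
  | last =>
    induction j using Fin.lastCases with
    | last => simp [hlt]
    | cast j => simp [hs]
  | cast i =>
    induction j using Fin.lastCases with
    | last => simp [hs, H.adj_comm, i.2.ne]
    | cast j => simp [i.2.ne, j.2.ne, ← h i j]

set_option maxRecDepth 100000 in
-- The computation on which completeness rests: every admissible one-vertex extension of a listed
-- graph is listed again, after reordering.
theorem codesClosed_eq_true : ∀ n < 9, codesClosed n = true := by decide +kernel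

theorem degree_comap_ne {V : Type} [Fintype V] [DecidableEq V] (H : SimpleGraph V)
    [DecidableRel H.Adj] (v : V) (w : {w // w ≠ v}) :
    H.degree w = (H.comap (Subtype.val : {w // w ≠ v} → V)).degree w +
      if H.Adj w v then 1 else 0 := by
  have h1 : ∀ {W : Type} [Fintype W] (K : SimpleGraph W) [DecidableRel K.Adj] (w : W),
      K.degree w = ∑ u, if K.Adj w u then 1 else 0 := by
    intro W _ K _ w
    rw [Finset.sum_boole, ← K.card_neighborFinset_eq_degree, K.neighborFinset_eq_filter]
    rfl
  rw [h1, h1, ← (Equiv.optionSubtypeNe v).sum_comp, Fintype.sum_option, add_comm]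
  rfl

theorem sum_degree_comap_ne {V : Type} [Fintype V] [DecidableEq V] (H : SimpleGraph V)
    [DecidableRel H.Adj] (v : V) :
    ∑ w, H.degree w = ∑ w, (H.comap (Subtype.val : {w // w ≠ v} → V)).degree w +
      2 * H.degree v := by
  have h : H.degree v = ∑ w : {w // w ≠ v}, if H.Adj w v then 1 else 0 := by
    rw [← H.card_neighborFinset_eq_degree, H.neighborFinset_eq_filter, Finset.card_filter,
      ← (Equiv.optionSubtypeNe v).sum_comp, Fintype.sum_option]
    simp [H.adj_comm]
  have key : ∀ f : V → ℕ, ∑ w, f w = f v + ∑ w : {w // w ≠ v}, f w := fun f => by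
    rw [← (Equiv.optionSubtypeNe v).sum_comp, Fintype.sum_option]
    rfl
  rw [key fun w => H.degree w, Finset.sum_congr rfl fun w _ => degree_comap_ne H v w,
    Finset.sum_add_distrib, ← h]
  ring

/-- Induction on the number of vertices, deleting a vertex of minimal degree. Its neighbourhood is
one of the sets tried in `codesClosed`, so the labelling of the smaller graph extends to a listed
code. -/
theorem exists_code {n : ℕ} (hn : n ≤ 9) {V : Type} [Fintype V] [DecidableEq V]
    (H : SimpleGraph V) [DecidableRel H.Adj] (hV : Fintype.card V = n)
    (htri : ∀ u v w, H.Adj u v → H.Adj v w → ¬ H.Adj u w) (hdeg : ∀ v, H.degree v ≤ 4)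
    (hsum : 2 * minEdges n ≤ ∑ v, H.degree v) : ∃ c ∈ codes n, Realizes n c H := by
  induction n generalizing V with
  | zero =>
    have := Fintype.card_eq_zero_iff.1 hV
    exact ⟨0, by simp [codes], (Fintype.equivFinOfCardEq hV).symm, fun i => i.elim0⟩
  | succ n ih =>
    have : Nonempty V := Fintype.card_pos_iff.1 (by omega)
    obtain ⟨v, hv⟩ := Finite.exists_min fun v => H.degree v
    have hle : (n + 1) * H.degree v ≤ ∑ w, H.degree w := by
      have := Finset.card_nsmul_le_sum Finset.univ (fun v => H.degree v) _ fun w _ => hv w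
      rwa [Finset.card_univ, hV, smul_eq_mul] at this
    have hsplit := sum_degree_comap_ne H v
    have hd := degree_comap_ne H v
    obtain ⟨c, hc, e, he⟩ := ih (V := {w // w ≠ v}) (by omega) (H.comap Subtype.val)
      (by rw [Fintype.card_subtype_compl, Fintype.card_subtype_eq, hV]; rfl)
      (fun u w x => htri u w x) (fun w => by have := hdeg w; have := hd w; omega)
      (by
        -- A minimal degree d satisfies d ≤ 4 and (n + 1) d ≤ 2e. The values of `minEdges` are such
        -- that these bounds and e ≥ `minEdges (n + 1)` force e - d ≥ `minEdges n`.
        have h4 := hdeg v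
        have hn' : n < 9 := by omega
        have heven := H.sum_degrees_eq_twice_card_edges
        clear hv ih hd
        generalize ∑ w, (H.comap (Subtype.val : {w // w ≠ v} → V)).degree w = X at *
        generalize ∑ w, H.degree w = Y at *
        generalize H.degree v = d at *
        interval_cases n <;> simp only [minEdges, List.getD_cons_zero, List.getD_cons_succ] at * <;>
          omega)
    set s := (List.range n).filter fun i => if h : i < n then decide (H.Adj v (e ⟨i, h⟩)) else false
      with hs_def
    have hs : ∀ i : Fin n, (i : ℕ) ∈ s ↔ H.Adj v (e i) := fun i => by simp [hs_def]
    have hsn : ∀ i ∈ s, i < n := fun i hi => List.mem_range.1 (List.mem_filter.1 hi).1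
    have hlen : s.length = H.degree v := by
      have h1 := sum_map_filter (List.range n)
        (fun i => if h : i < n then decide (H.Adj v (e ⟨i, h⟩)) else false) fun _ => 1
      rw [← hs_def, List.map_const', List.sum_replicate, smul_eq_mul, mul_one, sum_map_range] at h1
      rw [h1, ← H.card_neighborFinset_eq_degree, H.neighborFinset_eq_filter, Finset.card_filter,
        ← (Equiv.optionSubtypeNe v).sum_comp, Fintype.sum_option, ← e.sum_comp]
      simp
    have hdeg' : ∀ i : Fin n, H.degree (e i) = (codeNbrs n c i).length + if (i : ℕ) ∈ s then 1 else 0 :=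
      fun i => by
        rw [hd, he.length_nbrs]
        simp [hs, H.adj_comm]
    -- The neighbours of `v` are at most four, have degree at most three once `v` is removed, and
    -- are pairwise non-adjacent because there are no triangles.
    have hmem : s ∈ (independentSets n c (List.range n)).filter (isExtension n c) := by
      refine List.mem_filter.2 ⟨mem_independentSets List.filter_sublist (hlen ▸ hdeg v) ?_ ?_, ?_⟩
      · intro i hi
        have h1 := hdeg' ⟨i, hsn i hi⟩
        have h2 := hdeg (e ⟨i, hsn i hi⟩)
        rw [if_pos hi] at h1
        dsimp only at h1
        omega
      · refine List.Pairwise.imp_of_mem (R := fun _ _ => True) ?_ (List.pairwise_of_forall fun _ _ => trivial)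
        intro i j hi hj _
        have h1 := (hs ⟨i, hsn i hi⟩).1 hi
        have h2 := (hs ⟨j, hsn j hj⟩).1 hj
        have h3 := he ⟨i, hsn i hi⟩ ⟨j, hsn j hj⟩
        by_contra hcon
        exact htri _ _ _ h1 (h3.2 (by simpa using hcon)) h2
      · simp only [isExtension, Bool.and_eq_true, decide_eq_true_eq, List.all_eq_true,
          List.mem_range, List.elem_eq_mem]
        constructor
        · rw [he.degSum, hlen, ← hsplit]
          exact hsum
        · intro i hi
          rw [hlen, ← hdeg' ⟨i, hi⟩]
          exact hv _
    have hcl := codesClosed_eq_true n (by omega)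
    simp only [codesClosed, List.all_eq_true] at hcl
    exact ⟨_, List.elem_iff.1 (hcl c hc s hmem), (he.extend hn v hs hsn).canonCode hn⟩

/-! ### Isomorphism invariance of the hash -/

theorem getD_map_range {n : ℕ} (f : ℕ → ℕ) (i : Fin n) :
    ((List.range n).map f).getD i 0 = f i := by
  simp [List.getD_eq_getElem?_getD]

/-- The new colour depends only on the own colour and on the sum of the neighbours' colours, so a
round commutes with relabelling. -/
theorem getD_refineStep {n c c' : ℕ} (σ : Equiv.Perm (Fin n))
    (h : ∀ i j : Fin n, codeAdj c i j = codeAdj c' (σ i) (σ j)) {col col' : List ℕ}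
    (hcol : ∀ i : Fin n, col.getD i 0 = col'.getD (σ i) 0) (i : Fin n) :
    (refineStep n c col).getD i 0 = (refineStep n c' col').getD (σ i) 0 := by
  rw [refineStep, refineStep, getD_map_range, getD_map_range, codeNbrs, codeNbrs, sum_map_filter,
    sum_map_filter, sum_map_range, sum_map_range, hcol, Fintype.sum_equiv σ _
      (fun j : Fin n => if codeAdj c' (σ i) j then col'.getD j 0 else 0) fun j => by rw [h, hcol]]

theorem vertexHash_eq {n c c' : ℕ} (σ : Equiv.Perm (Fin n))
    (h : ∀ i j : Fin n, codeAdj c i j = codeAdj c' (σ i) (σ j)) (u : Fin n) :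
    vertexHash n c u = vertexHash n c' (σ u) := by
  have hsum : ∀ {c : ℕ} {col : List ℕ},
      (refineStep n c col).sum = ∑ i : Fin n, (refineStep n c col).getD i 0 := by
    intro c col
    have : (refineStep n c col) = (List.range n).map fun i => (refineStep n c col).getD i 0 :=
      List.ext_getElem (by simp [refineStep]) fun i h₁ h₂ => by
        simp only [List.getElem_map, List.getElem_range]
        rw [List.getD_eq_getElem _ _ h₁]
    conv_lhs => rw [this, sum_map_range]
  rw [vertexHash, vertexHash, hsum, hsum]
  refine Fintype.sum_equiv σ _ _ fun i => ?_
  refine getD_refineStep σ h (getD_refineStep σ h fun i => ?_) i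
  rw [getD_map_range, getD_map_range]
  simp only [Fin.val_inj, EmbeddingLike.apply_eq_iff_eq]

/-- Used in contraposition: codes with different hashes belong to non-isomorphic graphs. -/
theorem graphHash_eq {V : Type} {H : SimpleGraph V} {n c c' : ℕ} (hc : Realizes n c H)
    (hc' : Realizes n c' H) : graphHash n c = graphHash n c' := by
  obtain ⟨e, he⟩ := hc
  obtain ⟨e', he'⟩ := hc'
  have h : ∀ i j : Fin n, codeAdj c i j =
      codeAdj c' ((e.trans e'.symm) i) ((e.trans e'.symm) j) := fun i j => by
    rw [Bool.eq_iff_iff, ← he, ← he']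
    simp
  rw [graphHash, graphHash, sum_map_range, sum_map_range]
  exact Fintype.sum_equiv (e.trans e'.symm) _ _ fun i => by rw [vertexHash_eq _ h]

/-! ### Layers in graphs -/

/-- `B` arises from `A` by repeatedly adding a vertex with two neighbours in the set. -/
inductive Grows {V : Type} [DecidableEq V] (H : SimpleGraph V) (A : Finset V) : Finset V → Prop
  | refl : Grows H A A
  | step {B : Finset V} (v x y : V) : Grows H A B → v ∉ B → x ∈ B → y ∈ B → x ≠ y → H.Adj v x →
      H.Adj v y → Grows H A (insert v B)

/-- The vertices of `s :: l` form a cycle from which the whole graph grows. -/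
structure IsFillingCycle {V : Type} [DecidableEq V] [Fintype V] (H : SimpleGraph V) (s : V)
    (l : List V) : Prop where
  nodup : (s :: l).Nodup
  isChain : (s :: l).IsChain H.Adj
  adj_last : H.Adj ((s :: l).getLast (List.cons_ne_nil _ _)) s
  grows : Grows H (s :: l).toFinset Finset.univ

/-- The lengths of the cycles from which the whole graph grows. -/
def fillLengths {V : Type} [DecidableEq V] [Fintype V] (H : SimpleGraph V) : Set ℕ :=
  {k | 3 ≤ k ∧ ∃ s l, IsFillingCycle H s l ∧ l.length + 1 = k}

section Grows

variable {V : Type} [DecidableEq V] {H : SimpleGraph V}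

theorem Grows.subset {A B : Finset V} (h : Grows H A B) : A ⊆ B := by
  induction h with
  | refl => exact subset_rfl
  | step v x y _ _ _ _ _ _ _ ih => exact ih.trans (Finset.subset_insert _ _)

theorem Grows.trans {A B C : Finset V} (h : Grows H A B) (h' : Grows H B C) : Grows H A C := by
  induction h' with
  | refl => exact h
  | step v x y _ h1 h2 h3 h4 h5 h6 ih => exact ih.step v x y h1 h2 h3 h4 h5 h6

/-- Starting with an additional vertex never hurts; this is why the greedy choice in `codeFills`
loses nothing. -/
theorem Grows.insert {A B : Finset V} (h : Grows H A B) (v : V) :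
    Grows H (insert v A) (insert v B) := by
  induction h with
  | refl => exact .refl
  | @step B w x y _ h1 h2 h3 h4 h5 h6 ih =>
    rw [Finset.insert_comm]
    by_cases hw : w ∈ Insert.insert v B
    · rwa [Finset.insert_eq_of_mem hw]
    · exact ih.step w x y hw (Finset.mem_insert_of_mem h2) (Finset.mem_insert_of_mem h3) h4 h5 h6

/-- A set in which no outside vertex has two neighbours is stuck; this justifies the negative
answers of `codeFills`. -/
theorem Grows.eq_of_closed {A B : Finset V} (h : Grows H A B)
    (hA : ∀ v x y, v ∉ A → x ∈ A → y ∈ A → x ≠ y → H.Adj v x → ¬ H.Adj v y) : B = A := by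
  induction h with
  | refl => rfl
  | step v x y _ h1 h2 h3 h4 h5 h6 ih =>
    subst ih
    exact absurd h6 (hA v x y h1 h2 h3 h4 h5)

end Grows

/-! ### Correctness of the growth and cycle tests -/

theorem maskMem_eq_testBit (A i : ℕ) : maskMem A i = A.testBit i := by
  rw [Nat.testBit_eq_decide_div_mod_eq, maskMem]
  rfl

theorem maskMem_or (A i j : ℕ) : maskMem (2 ^ i ||| A) j = true ↔ j = i ∨ maskMem A j = true := by
  rw [maskMem_eq_testBit, maskMem_eq_testBit, Nat.testBit_or, Nat.testBit_two_pow,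
    Bool.or_eq_true, decide_eq_true_eq, eq_comm]

theorem IsLabelling.two_le_nbrs {V : Type} {H : SimpleGraph V} {n c : ℕ} {e : Fin n ≃ V} (h : IsLabelling c H e) {A : ℕ} {B : Finset V}
    (hAB : ∀ i : Fin n, maskMem A i = true ↔ e i ∈ B) (i : Fin n) :
    2 ≤ ((codeNbrs n c i).filter (maskMem A)).length ↔
      ∃ x y, x ∈ B ∧ y ∈ B ∧ x ≠ y ∧ H.Adj (e i) x ∧ H.Adj (e i) y := by
  have hnd : ((codeNbrs n c i).filter (maskMem A)).Nodup := (List.nodup_range.filter _).filter _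
  have hmem : ∀ j, j ∈ (codeNbrs n c i).filter (maskMem A) ↔
      ∃ h : j < n, e ⟨j, h⟩ ∈ B ∧ H.Adj (e i) (e ⟨j, h⟩) := fun j => by
    simp only [codeNbrs, List.mem_filter, List.mem_range]
    constructor
    · rintro ⟨⟨h1, h2⟩, h3⟩
      exact ⟨h1, (hAB ⟨j, h1⟩).1 h3, (h i ⟨j, h1⟩).2 h2⟩
    · rintro ⟨h1, h2, h3⟩
      exact ⟨⟨h1, (h i ⟨j, h1⟩).1 h3⟩, (hAB ⟨j, h1⟩).2 h2⟩
  rw [← List.toFinset_card_of_nodup hnd, Nat.succ_le_iff, Finset.one_lt_card]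
  simp only [List.mem_toFinset, hmem]
  constructor
  · rintro ⟨a, ⟨ha, ha1, ha2⟩, b, ⟨hb, hb1, hb2⟩, hab⟩
    exact ⟨_, _, ha1, hb1, fun h => hab (congrArg Fin.val (e.injective h)), ha2, hb2⟩
  · rintro ⟨x, y, hx, hy, hxy, hix, hiy⟩
    refine ⟨e.symm x, ⟨(e.symm x).2, ?_⟩, e.symm y, ⟨(e.symm y).2, ?_⟩, fun h =>
      hxy (e.symm.injective (Fin.ext h))⟩
    · simp [hx, hix]
    · simp [hy, hiy]

section Labelling

variable {V : Type} [DecidableEq V] [Fintype V] {H : SimpleGraph V} {n c : ℕ} {e : Fin n ≃ V}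

/-- Each round adds a vertex, so `k` rounds suffice when at most `k` vertices are missing. A
positive round is harmless by `Grows.insert`, and a failing search means that the set is closed. -/
theorem IsLabelling.codeFills_iff (h : IsLabelling c H e) (k : ℕ) {A : ℕ} {B : Finset V}
    (hAB : ∀ i : Fin n, maskMem A i = true ↔ e i ∈ B) (hk : n ≤ B.card + k) :
    codeFills n c k A = true ↔ Grows H B Finset.univ := by
  have hall : ∀ {A : ℕ} {B : Finset V}, (∀ i : Fin n, maskMem A i = true ↔ e i ∈ B) →
      ((List.range n).all (maskMem A) = true ↔ B = Finset.univ) := by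
    intro A B hAB
    simp only [List.all_eq_true, List.mem_range, Finset.eq_univ_iff_forall]
    exact ⟨fun h v => by simpa using (hAB (e.symm v)).1 (h _ (e.symm v).2),
      fun h i hi => (hAB ⟨i, hi⟩).2 (h _)⟩
  have hcard : Fintype.card V = n := by rw [← Fintype.card_congr e, Fintype.card_fin]
  induction k generalizing A B with
  | zero =>
    have hB : B = Finset.univ := by
      rw [← Finset.card_eq_iff_eq_univ]
      have := Finset.card_le_univ B
      omega
    rw [codeFills, hall hAB]
    exact ⟨fun _ => hB ▸ .refl, fun _ => hB⟩
  | succ k ih =>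
    rw [codeFills]
    cases hnext : nextVertex n c A with
    | some i =>
      have hi := List.mem_of_find?_eq_some hnext
      have hi' := List.find?_some hnext
      rw [List.mem_range] at hi
      simp only [Bool.and_eq_true, Bool.not_eq_true', decide_eq_true_eq] at hi'
      have hiB : e ⟨i, hi⟩ ∉ B := fun hcon => by
        have := (hAB ⟨i, hi⟩).2 hcon
        simp_all
      obtain ⟨x, y, hx, hy, hxy, hvx, hvy⟩ := (h.two_le_nbrs hAB ⟨i, hi⟩).1 hi'.2
      have hAB' : ∀ j : Fin n, maskMem (2 ^ i ||| A) j = true ↔ e j ∈ insert (e ⟨i, hi⟩) B := fun j => by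
        rw [maskMem_or, Finset.mem_insert, hAB, e.injective.eq_iff, Fin.ext_iff]
      dsimp only
      refine (ih hAB' (by rw [Finset.card_insert_of_notMem hiB]; omega)).trans ⟨?_, ?_⟩
      · exact (Grows.refl.step _ x y hiB hx hy hxy hvx hvy).trans
      -- Inserting the new vertex into both ends leaves `Finset.univ` unchanged.
      · intro hg
        simpa using hg.insert (e ⟨i, hi⟩)
    | none =>
      dsimp only
      rw [hall hAB]
      refine ⟨fun hB => hB ▸ .refl, fun hg => (hg.eq_of_closed ?_).symm⟩
      intro v x y hv hx hy hxy hvx hvy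
      have := List.find?_eq_none.1 hnext (e.symm v) (List.mem_range.2 (e.symm v).2)
      refine this ?_
      rw [Bool.and_eq_true, decide_eq_true_eq, h.two_le_nbrs hAB]
      refine ⟨?_, x, y, hx, hy, hxy, by simpa using hvx, by simpa using hvy⟩
      rw [Bool.not_eq_true', ← Bool.not_eq_true, hAB]
      simpa using hv

/-- The mask `A` records the set `B` of vertices visited so far, and `l` is the part of the cycle
still to come. -/
theorem IsLabelling.codeCycleFrom_iff (h : IsLabelling c H e) (s : Fin n) (k : ℕ) (v : Fin n)
    {A : ℕ} {B : Finset V} (hAB : ∀ i : Fin n, maskMem A i = true ↔ e i ∈ B) :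
    codeCycleFrom n c s k v A = true ↔ ∃ l : List V, l.length = k ∧ (e v :: l).IsChain H.Adj ∧
      l.Nodup ∧ (∀ x ∈ l, x ∉ B) ∧
      H.Adj ((e v :: l).getLast (List.cons_ne_nil _ _)) (e s) ∧
      Grows H (B ∪ l.toFinset) Finset.univ := by
  induction k generalizing v A B with
  | zero =>
    rw [codeCycleFrom, Bool.and_eq_true, h.codeFills_iff n hAB (Nat.le_add_left _ _), ← h v s]
    simp
  | succ k ih =>
    simp only [codeCycleFrom, List.any_eq_true, Bool.and_eq_true, codeNbrs, List.mem_filter,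
      List.mem_range, Bool.not_eq_true', ← Bool.not_eq_true]
    have hAB' : ∀ w j : Fin n, maskMem (2 ^ (w : ℕ) ||| A) j = true ↔ e j ∈ insert (e w) B := fun w j => by
      rw [maskMem_or, Finset.mem_insert, hAB, e.injective.eq_iff, Fin.ext_iff]
    constructor
    · rintro ⟨w, ⟨hw, hvw⟩, hwA, hcyc⟩
      obtain ⟨l, hl, hch, hnd, hB, hlast, hg⟩ := (ih ⟨w, hw⟩ (hAB' ⟨w, hw⟩)).1 hcyc
      refine ⟨e ⟨w, hw⟩ :: l, by simp [hl], List.isChain_cons_cons.2 ⟨(h v ⟨w, hw⟩).2 hvw, hch⟩,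
        List.nodup_cons.2 ⟨fun hm => hB _ hm (Finset.mem_insert_self _ _), hnd⟩, ?_, ?_, ?_⟩
      · intro x hx
        rcases List.mem_cons.1 hx with rfl | hx
        · exact fun hm => hwA ((hAB ⟨w, hw⟩).2 hm)
        · exact fun hm => hB x hx (Finset.mem_insert_of_mem hm)
      · rw [List.getLast_cons (List.cons_ne_nil _ _)]
        exact hlast
      · rwa [List.toFinset_cons, Finset.union_insert, ← Finset.insert_union]
    · rintro ⟨l, hl, hch, hnd, hB, hlast, hg⟩
      obtain _ | ⟨w, l⟩ := l
      · simp at hl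
      obtain ⟨w, rfl⟩ := e.surjective w
      rw [List.isChain_cons_cons] at hch
      rw [List.nodup_cons] at hnd
      refine ⟨w, ⟨w.2, (h v w).1 hch.1⟩, fun hm => hB (e w) List.mem_cons_self ((hAB w).1 hm),
        (ih w (hAB' w)).2 ⟨l, by simpa using hl, hch.2, hnd.2, ?_, ?_, ?_⟩⟩
      · intro x hx hm
        rcases Finset.mem_insert.1 hm with rfl | hm
        · exact hnd.1 hx
        · exact hB x (List.mem_cons_of_mem _ hx) hm
      · rwa [List.getLast_cons (List.cons_ne_nil _ _)] at hlast
      · rwa [List.toFinset_cons, Finset.union_insert, ← Finset.insert_union] at hg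

theorem IsLabelling.codeHasCycle_iff (h : IsLabelling c H e) (k : ℕ) (hk : 2 ≤ k) :
    codeHasCycle n c k = true ↔ k + 1 ∈ fillLengths H := by
  have hAB : ∀ s i : Fin n, maskMem (2 ^ (s : ℕ)) i = true ↔ e i ∈ ({e s} : Finset V) := fun s i => by
    rw [maskMem_eq_testBit, Nat.testBit_two_pow, decide_eq_true_eq, Finset.mem_singleton,
      e.injective.eq_iff, Fin.ext_iff, eq_comm]
  simp only [codeHasCycle, List.any_eq_true, List.mem_range]
  constructor
  · rintro ⟨s, hs, hcyc⟩
    obtain ⟨l, hl, hch, hnd, hB, hlast, hg⟩ :=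
      (h.codeCycleFrom_iff ⟨s, hs⟩ k ⟨s, hs⟩ (hAB ⟨s, hs⟩)).1 hcyc
    refine ⟨by omega, e ⟨s, hs⟩, l, ⟨List.nodup_cons.2
      ⟨fun hm => hB _ hm (Finset.mem_singleton_self _), hnd⟩, hch, hlast, ?_⟩, by omega⟩
    rwa [List.toFinset_cons, Finset.insert_eq]
  · rintro ⟨-, s, l, ⟨hnd, hch, hlast, hg⟩, hl⟩
    obtain ⟨s, rfl⟩ := e.surjective s
    rw [List.nodup_cons] at hnd
    rw [List.toFinset_cons, Finset.insert_eq] at hg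
    refine ⟨s, s.2, (h.codeCycleFrom_iff s k s (hAB s)).2
      ⟨l, by omega, hch, hnd.2, fun x hx hm => ?_, hlast, hg⟩⟩
    rw [Finset.mem_singleton] at hm
    exact hnd.1 (hm ▸ hx)

/-- Without triangles the shortest possible filling cycle has length 4, and `codeType` tries 4, 5, 6
in turn. The factor 2 passes to lengths in the Tanner graph. -/
theorem IsLabelling.isLeast_codeType (h : IsLabelling c H e)
    (htri : ∀ u v w, H.Adj u v → H.Adj v w → ¬ H.Adj u w) (hc : codeType n c ≠ 0) :
    IsLeast ((2 * ·) '' fillLengths H) (codeType n c) := by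
  have h3 : 3 ∉ fillLengths H := by
    rintro ⟨-, s, l, hl, hlen⟩
    match l, hlen with
    | [a, b], _ =>
      have hch := hl.isChain
      simp only [List.isChain_cons_cons] at hch
      exact htri _ _ _ hch.1 hch.2.1 hl.adj_last.symm
  have h4 := h.codeHasCycle_iff 3 (by omega)
  have h5 := h.codeHasCycle_iff 4 (by omega)
  have h6 := h.codeHasCycle_iff 5 (by omega)
  have key : ∀ k, k ∈ fillLengths H → k ≠ 3 ∧ 3 ≤ k := fun k hk => ⟨fun h => h3 (h ▸ hk), hk.1⟩
  unfold codeType at hc ⊢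
  split_ifs at hc ⊢ with h4' h5' h6'
  · refine ⟨⟨4, h4.1 h4', rfl⟩, ?_⟩
    rintro _ ⟨k, hk, rfl⟩
    have := key k hk
    dsimp only
    omega
  · refine ⟨⟨5, h5.1 h5', rfl⟩, ?_⟩
    rintro _ ⟨k, hk, rfl⟩
    have := key k hk
    have : k ≠ 4 := fun hk4 => h4' (h4.2 (by rwa [hk4] at hk))
    dsimp only
    omega
  · refine ⟨⟨6, h6.1 h6', rfl⟩, ?_⟩
    rintro _ ⟨k, hk, rfl⟩
    have := key k hk
    have : k ≠ 4 := fun hk4 => h4' (h4.2 (by rwa [hk4] at hk))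
    have : k ≠ 5 := fun hk5 => h5' (h5.2 (by rwa [hk5] at hk))
    dsimp only
    omega
  · exact absurd rfl hc

end Labelling

namespace TannerGraph

/-! ### The normal graph of a Tanner graph -/

variable {L R : Type} {G : TannerGraph L R} {S A C : Finset L}

/-- The graph on the variable nodes in which two nodes are joined if they share a check node. -/
def normal (G : TannerGraph L R) : SimpleGraph L where
  Adj u w := u ≠ w ∧ ∃ c, G.adj u c ∧ G.adj w c
  symm := ⟨fun _ _ ⟨h, c, hu, hw⟩ => ⟨h.symm, c, hw, hu⟩⟩
  loopless := ⟨fun _ h => h.1 rfl⟩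

/-- Two variable nodes share at most one check node. -/
def IsLinear (G : TannerGraph L R) : Prop :=
  ∀ u w c d, u ≠ w → G.adj u c → G.adj w c → G.adj u d → G.adj w d → c = d

theorem finite_checkNbrs (S : Finset L) (c : R) : {v : L | v ∈ S ∧ G.adj v c}.Finite :=
  S.finite_toSet.subset fun _ h => h.1

/-- The working form of elementarity: no check has three neighbours in `S`. -/
theorem IsElementary.eq_or_eq (hS : G.IsElementary S) {x y z : L} {c : R} (hx : x ∈ S)
    (hy : y ∈ S) (hz : z ∈ S) (hxc : G.adj x c) (hyc : G.adj y c) (hzc : G.adj z c)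
    (hxy : x ≠ y) : z = x ∨ z = y := by
  by_contra! hcon
  have h3 : ({x, y, z} : Set L).ncard = 3 :=
    Set.ncard_eq_three.2 ⟨x, y, z, hxy, hcon.1.symm, hcon.2.symm, rfl⟩
  have hle : ({x, y, z} : Set L).ncard ≤ G.checkDegree S c := by
    refine Set.ncard_le_ncard ?_ (finite_checkNbrs S c)
    rintro w (rfl | rfl | rfl)
    exacts [⟨hx, hxc⟩, ⟨hy, hyc⟩, ⟨hz, hzc⟩]
  rcases hS c ⟨x, hx, hxc⟩ with h | h <;> omega

theorem IsElementary.mem_satisfied_iff (hS : G.IsElementary S) {v : L} {c : R} (hv : v ∈ S)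
    (hvc : G.adj v c) : c ∈ G.satisfied S ↔ ∃ w ∈ S, v ≠ w ∧ G.adj w c := by
  have hc : c ∈ G.checks S := ⟨v, hv, hvc⟩
  constructor
  · rintro ⟨-, heven⟩
    have h2 : 1 < G.checkDegree S c := by
      rcases hS c hc with h | h
      · rw [h] at heven
        exact absurd heven (by decide)
      · omega
    obtain ⟨w, hw, hwv⟩ := Set.exists_ne_of_one_lt_ncard h2 v
    exact ⟨w, hw.1, hwv.symm, hw.2⟩
  · rintro ⟨w, hw, hvw, hwc⟩
    have hle : ({v, w} : Set L).ncard ≤ G.checkDegree S c := by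
      refine Set.ncard_le_ncard ?_ (finite_checkNbrs S c)
      rintro x (rfl | rfl)
      exacts [⟨hv, hvc⟩, ⟨hw, hwc⟩]
    rw [Set.ncard_pair hvw] at hle
    refine ⟨hc, ?_⟩
    rcases hS c hc with h | h
    · omega
    · rw [h]
      decide

theorem IsElementary.mem_unsatisfied_iff (hS : G.IsElementary S) {v : L} {c : R} (hv : v ∈ S)
    (hvc : G.adj v c) : c ∈ G.unsatisfied S ↔ ∀ w ∈ S, G.adj w c → w = v := by
  have h := hS.mem_satisfied_iff hv hvc
  have hc : c ∈ G.checks S := ⟨v, hv, hvc⟩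
  have h' : c ∈ G.unsatisfied S ↔ c ∉ G.satisfied S := by
    simp only [unsatisfied, satisfied, Set.mem_ofPred_eq, hc, true_and, Nat.not_even_iff_odd]
  rw [h', h]
  push Not
  exact ⟨fun h w hw hwc => by_contra fun hne => h w hw (Ne.symm hne) hwc,
    fun h w hw hne hwc => hne (h w hw hwc).symm⟩

theorem IsElementary.mono (hS : G.IsElementary S) (hA : A ⊆ S) : G.IsElementary A := by
  rintro c ⟨v, hv, hvc⟩
  have h1 : 0 < G.checkDegree A c :=
    (Set.ncard_pos (finite_checkNbrs A c)).2 ⟨v, hv, hvc⟩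
  have h2 : G.checkDegree A c ≤ G.checkDegree S c :=
    Set.ncard_le_ncard (fun w hw => ⟨hA hw.1, hw.2⟩) (finite_checkNbrs S c)
  rcases hS c ⟨v, hA hv, hvc⟩ with h | h <;> omega

/-- Sending a neighbour to a shared check is a bijection: injective because a check has at most two
neighbours in `S`, surjective because two nodes share at most one check. -/
theorem ncard_satisfied (hG : G.IsLinear) (hS : G.IsElementary S) {v : L} (hv : v ∈ S) :
    {c : R | c ∈ G.satisfied S ∧ G.adj v c}.ncard =
      {w : L | w ∈ S ∧ G.normal.Adj v w}.ncard := by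
  symm
  refine Set.ncard_congr (fun w hw => hw.2.2.choose) ?_ ?_ ?_
  · intro w hw
    have h := hw.2.2.choose_spec
    exact ⟨(hS.mem_satisfied_iff hv h.1).2 ⟨w, hw.1, hw.2.1, h.2⟩, h.1⟩
  · intro w x hw hx h
    have h1 := hw.2.2.choose_spec
    have h2 := hx.2.2.choose_spec
    rw [← h] at h2
    rcases hS.eq_or_eq hv hw.1 hx.1 h1.1 h1.2 h2.2 hw.2.1 with h3 | h3
    · exact absurd h3.symm hx.2.1
    · exact h3.symm
  · rintro c ⟨hc, hvc⟩
    obtain ⟨w, hw, hvw, hwc⟩ := (hS.mem_satisfied_iff hv hvc).1 hc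
    have hw' : w ∈ S ∧ G.normal.Adj v w := ⟨hw, hvw, c, hvc, hwc⟩
    have h := hw'.2.2.choose_spec
    exact ⟨w, hw', hG _ _ _ _ hvw h.1 h.2 hvc hwc⟩

theorem ncard_unsatisfied_add [Finite R] {d : ℕ} (hd : G.LeftRegular d) (hG : G.IsLinear)
    (hS : G.IsElementary S) {v : L} (hv : v ∈ S) :
    {c : R | c ∈ G.unsatisfied S ∧ G.adj v c}.ncard +
      {w : L | w ∈ S ∧ G.normal.Adj v w}.ncard = d := by
  rw [← ncard_satisfied hG hS hv, ← hd v, ← Set.ncard_union_eq]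
  · congr 1
    ext c
    have h : G.adj v c → c ∈ G.checks S := fun h => ⟨v, hv, h⟩
    have := Nat.even_or_odd (G.checkDegree S c)
    simp only [satisfied, unsatisfied, Set.mem_union, Set.mem_ofPred_eq]
    tauto
  · rw [Set.disjoint_left]
    rintro c ⟨⟨-, h1⟩, -⟩ ⟨⟨-, h2⟩, -⟩
    exact Nat.not_even_iff_odd.2 h1 h2

/-- An unsatisfied check of an elementary set has exactly one neighbour in `S`, so the sets on the
right are disjoint. -/
theorem ncard_unsatisfied_eq_sum [Finite R] (hS : G.IsElementary S) :
    (G.unsatisfied S).ncard = ∑ v ∈ S, {c : R | c ∈ G.unsatisfied S ∧ G.adj v c}.ncard := by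
  classical
  have := Fintype.ofFinite R
  simp only [Set.ncard_eq_toFinset_card']
  rw [← Finset.card_biUnion]
  · congr 1
    ext c
    simp only [Set.mem_toFinset, Finset.mem_biUnion, Set.mem_ofPred_eq]
    exact ⟨fun h => let ⟨v, hv, hvc⟩ := h.1; ⟨v, hv, h, hvc⟩, fun ⟨v, hv, h, hvc⟩ => h⟩
  · intro v hv w hw hvw
    rw [Function.onFun, Finset.disjoint_left]
    intro c hc hc'
    rw [Set.mem_toFinset] at hc hc'
    exact hvw ((hS.mem_unsatisfied_iff hw hc'.2).1 hc.1 v hv hc.2)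

/-- Two vertices of `A` are joined by a path in `A`. -/
def Linked (G : TannerGraph L R) (A : Finset L) : L → L → Prop :=
  Relation.ReflTransGen fun u w => u ∈ A ∧ w ∈ A ∧ G.normal.Adj u w

theorem Linked.mono (h : A ⊆ S) {u w : L} (huw : G.Linked A u w) : G.Linked S u w :=
  Relation.ReflTransGen.mono (fun _ _ h' => ⟨h h'.1, h h'.2.1, h'.2.2⟩) _ _ huw

/-- Paths of the normal graph lift through the shared checks. The converse is not needed, as
connectedness of a given ETS only serves to make it nonempty. -/
theorem connected_of_linked {r : L} (hr : r ∈ A) (h : ∀ v ∈ A, G.Linked A r v) :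
    (G.inducedSubgraph A).Connected := by
  have hmem : ∀ {v}, v ∈ A → (Sum.inl v : L ⊕ R) ∈ G.nodes A := fun hv => Or.inl ⟨_, hv, rfl⟩
  have hmem' : ∀ {v c}, v ∈ A → G.adj v c → (Sum.inr c : L ⊕ R) ∈ G.nodes A :=
    fun hv hc => Or.inr ⟨_, ⟨_, hv, hc⟩, rfl⟩
  have hadj : ∀ {v c} (hv : v ∈ A) (hc : G.adj v c),
      (G.inducedSubgraph A).Adj ⟨_, hmem hv⟩ ⟨_, hmem' hv hc⟩ := fun hv hc => hc
  have key : ∀ v (hv : v ∈ A), (G.inducedSubgraph A).Reachable ⟨_, hmem hr⟩ ⟨_, hmem hv⟩ := by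
    intro v hv
    have hl := h v hv
    induction hl with
    | refl => exact SimpleGraph.Reachable.refl _
    | tail _ huw ih =>
      obtain ⟨hu, hw, -, c, huc, hwc⟩ := huw
      exact (ih hu).trans ((hadj hu huc).reachable.trans (hadj hw hwc).symm.reachable)
  have key' : ∀ x, (G.inducedSubgraph A).Reachable ⟨_, hmem hr⟩ x := by
    rintro ⟨_, ⟨v, hv, rfl⟩ | ⟨c, ⟨v, hv, hvc⟩, rfl⟩⟩
    · exact key v hv
    · exact (key v hv).trans (hadj hv hvc).reachable
  have : Nonempty (G.nodes A) := ⟨⟨_, hmem hr⟩⟩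
  exact ⟨fun x y => (key' x).symm.trans (key' y)⟩

/-- `A` is connected and every vertex of `A` has two neighbours in `A`. -/
def IsSolid (G : TannerGraph L R) (A : Finset L) : Prop :=
  (∃ r ∈ A, ∀ v ∈ A, G.Linked A r v) ∧
    ∀ v ∈ A, ∃ x ∈ A, ∃ y ∈ A, x ≠ y ∧ G.normal.Adj v x ∧ G.normal.Adj v y

theorem two_le_ncard_satisfied_iff (hG : G.IsLinear) (hA : G.IsElementary A) {v : L}
    (hv : v ∈ A) : 2 ≤ {c : R | c ∈ G.satisfied A ∧ G.adj v c}.ncard ↔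
      ∃ x ∈ A, ∃ y ∈ A, x ≠ y ∧ G.normal.Adj v x ∧ G.normal.Adj v y := by
  rw [ncard_satisfied hG hA hv, Nat.succ_le_iff,
    Set.one_lt_ncard (A.finite_toSet.subset fun _ h => h.1)]
  constructor
  · rintro ⟨x, hx, y, hy, hxy⟩
    exact ⟨x, hx.1, y, hy.1, hxy, hx.2, hy.2⟩
  · rintro ⟨x, hx, y, hy, hxy, hvx, hvy⟩
    exact ⟨x, ⟨hx, hvx⟩, y, ⟨hy, hvy⟩, hxy⟩

theorem IsSolid.isETS (hG : G.IsLinear) (hA : G.IsElementary A) (h : G.IsSolid A) : G.IsETS A := by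
  obtain ⟨⟨r, hr, hl⟩, h2⟩ := h
  exact ⟨hA, connected_of_linked hr hl, fun v hv =>
    (two_le_ncard_satisfied_iff hG hA hv).2 (h2 v hv)⟩

theorem IsSolid.insert [DecidableEq L] (h : G.IsSolid A) {v x y : L} (hx : x ∈ A) (hy : y ∈ A)
    (hxy : x ≠ y) (hvx : G.normal.Adj v x) (hvy : G.normal.Adj v y) :
    G.IsSolid (insert v A) := by
  obtain ⟨⟨r, hr, hl⟩, h2⟩ := h
  have hsub : A ⊆ Insert.insert v A := Finset.subset_insert _ _
  refine ⟨⟨r, hsub hr, fun w hw => ?_⟩, fun w hw => ?_⟩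
  · rcases Finset.mem_insert.1 hw with rfl | hw
    · exact ((hl x hx).mono hsub).tail ⟨hsub hx, Finset.mem_insert_self _ _, hvx.symm⟩
    · exact (hl w hw).mono hsub
  · rcases Finset.mem_insert.1 hw with rfl | hw
    · exact ⟨x, hsub hx, y, hsub hy, hxy, hvx, hvy⟩
    · obtain ⟨a, ha, b, hb, hab⟩ := h2 w hw
      exact ⟨a, hsub ha, b, hsub hb, hab⟩

/-! ### Layered supersets in the normal graph -/

/-- The single node added in a step has two satisfied checks in the enlarged set, hence two
neighbours there, and these are old nodes. -/
theorem IsLSS.grows [DecidableEq L] (hG : G.IsLinear) (h : G.IsLSS C S) :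
    Grows G.normal C S := by
  obtain ⟨n, T, rfl, rfl, hsub, hT⟩ := h
  have key : ∀ i ≤ n, Grows G.normal (T 0) (T i) := by
    intro i hi
    induction i with
    | zero => exact .refl
    | succ i ih =>
      have hss := hsub i (by omega)
      have hcard : (T (i + 1) \ T i).card = 1 := by
        rw [Finset.card_sdiff_of_subset hss, (hT _ hi).1, (hT i (by omega)).1]
        omega
      obtain ⟨v, hv⟩ := Finset.card_eq_one.1 hcard
      have hins : T (i + 1) = Insert.insert v (T i) := by
        rw [Finset.insert_eq, ← hv, Finset.sdiff_union_of_subset hss]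
      have hvmem : v ∈ T (i + 1) \ T i := hv ▸ Finset.mem_singleton_self v
      rw [Finset.mem_sdiff] at hvmem
      have hets := (hT _ hi).2
      obtain ⟨x, hx, y, hy, hxy, hvx, hvy⟩ :=
        (two_le_ncard_satisfied_iff hG hets.1 hvmem.1).1 (hets.2.2 v hvmem.1)
      rw [hins] at hx hy ⊢
      exact (ih (by omega)).step v x y hvmem.2 (Finset.mem_of_mem_insert_of_ne hx hvx.ne')
        (Finset.mem_of_mem_insert_of_ne hy hvy.ne') hxy hvx hvy
  exact key n le_rfl

/-- All intermediate sets lie in `S`, so they are elementary, and a node with two neighbours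
preserves solidity; hence each of them is an ETS in 𝒯. -/
theorem isLSS_of_grows [DecidableEq L] (hG : G.IsLinear) (hS : G.IsElementary S)
    (hC : G.IsSolid C) (h : Grows G.normal C S) : G.IsLSS C S ∧ G.IsSolid S := by
  induction h with
  | refl =>
    exact ⟨⟨0, fun _ => C, rfl, rfl, by simp, fun i hi => by
      obtain rfl : i = 0 := by omega
      exact ⟨rfl, hC.isETS hG hS⟩⟩, hC⟩
  | @step B v x y _ hv hx hy hxy hvx hvy ih =>
    obtain ⟨⟨n, T, h0, hn, hsub, hT⟩, hB⟩ := ih (hS.mono (Finset.subset_insert _ _))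
    have hB' := hB.insert hx hy hxy hvx hvy
    refine ⟨⟨n + 1, fun i => if i ≤ n then T i else Insert.insert v B, by simpa using h0, by simp,
      fun i hi => ?_, fun i hi => ?_⟩, hB'⟩
    · rw [Order.lt_add_one_iff] at hi
      simp only [hi, if_true]
      split_ifs with h
      · exact hsub i (by omega)
      · obtain rfl : i = n := by omega
        exact hn ▸ Finset.subset_insert _ _
    · dsimp only
      split_ifs with h
      · exact hT i h
      · obtain rfl : i = n + 1 := by omega
        refine ⟨?_, hB'.isETS hG hS⟩
        rw [Finset.card_insert_of_notMem hv, ← hn, (hT n le_rfl).1, add_assoc]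

end TannerGraph

namespace TannerGraph

/-! ### Cycles of a Tanner graph and of its normal graph -/

variable {L R : Type} {G : TannerGraph L R} {S C : Finset L}

theorem graph_adj_left {v : L} {y : L ⊕ R} (h : G.graph.Adj (Sum.inl v) y) :
    ∃ c, y = Sum.inr c ∧ G.adj v c := by
  rcases y with w | c
  · exact h.elim
  · exact ⟨c, rfl, h⟩

theorem graph_adj_right {c : R} {y : L ⊕ R} (h : G.graph.Adj (Sum.inr c) y) :
    ∃ v, y = Sum.inl v ∧ G.adj v c := by
  rcases y with v | d
  · exact ⟨v, rfl, h⟩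
  · exact h.elim

/-- The path alternates between the two sides, so it is read two edges at a time, keeping the
variable nodes. -/
theorem exists_list_of_path {s : L} (n : ℕ) {v : L} (q : G.graph.Walk (Sum.inl v) (Sum.inl s))
    (hq : q.IsPath) (hn : q.length ≤ n) : ∃ l : List L, (v :: l).IsChain G.normal.Adj ∧
      (v :: l).Nodup ∧ (v :: l).getLast (List.cons_ne_nil _ _) = s ∧ q.length = 2 * l.length ∧
      ∀ x, Sum.inl x ∈ q.support ↔ x ∈ v :: l := by
  induction n using Nat.strong_induction_on generalizing v with
  | _ n ih =>
    cases q with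
    | nil => exact ⟨[], by simp⟩
    | cons h q =>
      obtain ⟨c, rfl, hvc⟩ := graph_adj_left h
      cases q with
      | cons h' q =>
        obtain ⟨w, rfl, hwc⟩ := graph_adj_right h'
        rw [SimpleGraph.Walk.cons_isPath_iff, SimpleGraph.Walk.cons_isPath_iff] at hq
        simp only [SimpleGraph.Walk.length_cons] at hn ⊢
        obtain ⟨l, hch, hnd, hlast, hlen, hsupp⟩ := ih (n - 1) (by omega) q hq.1.1 (by omega)
        have hv : v ∉ w :: l := by
          rw [← hsupp]
          simpa using hq.2
        refine ⟨w :: l, List.isChain_cons_cons.2 ⟨⟨fun h => hv (h ▸ List.mem_cons_self),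
          c, hvc, hwc⟩, hch⟩, List.nodup_cons.2 ⟨hv, hnd⟩, ?_, ?_, fun x => ?_⟩
        · rwa [List.getLast_cons (List.cons_ne_nil _ _)]
        · rw [List.length_cons]
          omega
        · simp [hsupp]

/-- The vertices of `s :: l` form a cycle of the normal graph. -/
structure IsCycleList (G : TannerGraph L R) (s : L) (l : List L) : Prop where
  nodup : (s :: l).Nodup
  isChain : (s :: l).IsChain G.normal.Adj
  adj_last : G.normal.Adj ((s :: l).getLast (List.cons_ne_nil _ _)) s
  two_le : 2 ≤ l.length

theorem exists_cycleList (hG : G.IsLinear) {u : L ⊕ R} {w : G.graph.Walk u u} (hw : w.IsCycle) :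
    ∃ s l, G.IsCycleList s l ∧ w.length = 2 * (l.length + 1) ∧
      ∀ x, Sum.inl x ∈ w.support ↔ x ∈ s :: l := by
  classical
  -- A cycle based at a check node is rotated to its next variable node.
  wlog hu : ∃ s, u = Sum.inl s generalizing u
  · rcases u with s | c
    · exact absurd ⟨s, rfl⟩ hu
    cases w with
    | nil => exact absurd hw (by simp)
    | cons h q =>
      obtain ⟨v, rfl, hvc⟩ := graph_adj_right h
      have hmem : Sum.inl v ∈ (SimpleGraph.Walk.cons h q).support := by simp
      obtain ⟨s, l, h1, h2, h3⟩ := this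
        ((SimpleGraph.Walk.isCycle_rotate hmem).2 hw) ⟨v, rfl⟩
      refine ⟨s, l, h1, by rw [← h2, SimpleGraph.Walk.length_rotate], fun x => ?_⟩
      rw [← h3, SimpleGraph.Walk.mem_support_rotate_iff]
  obtain ⟨s, rfl⟩ := hu
  have hlen := hw.three_le_length
  cases w with
  | nil => simp at hlen
  | cons h q =>
    obtain ⟨c, rfl, hsc⟩ := graph_adj_left h
    cases q with
    | cons h' q =>
      obtain ⟨v, rfl, hvc⟩ := graph_adj_right h'
      rw [SimpleGraph.Walk.cons_isCycle_iff, SimpleGraph.Walk.cons_isPath_iff] at hw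
      obtain ⟨⟨hq, hcq⟩, -⟩ := hw
      obtain ⟨l, hch, hnd, hlast, hl, hsupp⟩ := exists_list_of_path _ q hq le_rfl
      simp only [SimpleGraph.Walk.length_cons] at hlen ⊢
      have hne : s ≠ v := by
        rintro rfl
        rw [SimpleGraph.Walk.isPath_iff_nil, ← SimpleGraph.Walk.length_eq_zero_iff] at hq
        simp [hq] at hlen
      -- Otherwise the cycle has length 4, and linearity identifies its two checks.
      have h4 : q.length ≠ 2 := by
        intro h2
        cases q with
        | nil => exact hne rfl
        | cons h1 q =>
          obtain ⟨d, rfl, hvd⟩ := graph_adj_left h1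
          cases q with
          | cons h3 q =>
            cases q with
            | nil =>
              refine hcq ?_
              rw [hG s v c d hne hsc hvc h3 hvd]
              simp
            | cons h5 q => simp at h2
      refine ⟨v, l, ⟨hnd, hch, hlast ▸ ⟨hne, c, hsc, hvc⟩, by omega⟩, by omega, fun x => ?_⟩
      rw [← hsupp]
      simp only [SimpleGraph.Walk.support_cons, List.mem_cons, reduceCtorEq, false_or,
        or_iff_right_iff_imp]
      rintro h
      obtain rfl : x = s := Sum.inl_injective h
      exact q.end_mem_support

/-- The last clause carries the induction: a check already on the path has two neighbours among the
later nodes, so by elementarity it cannot be the one joining `v` to `w`. -/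
theorem exists_path_of_list (hS : G.IsElementary S) {v : L} {l : List L}
    (hl : ∀ x ∈ v :: l, x ∈ S) (hch : (v :: l).IsChain G.normal.Adj) (hnd : (v :: l).Nodup)
    {t : L} (ht : (v :: l).getLast (List.cons_ne_nil _ _) = t) :
    ∃ q : G.graph.Walk (Sum.inl v) (Sum.inl t),
      q.IsPath ∧ q.length = 2 * l.length ∧ (∀ x, Sum.inl x ∈ q.support ↔ x ∈ v :: l) ∧
      ∀ c, Sum.inr c ∈ q.support → ∃ x ∈ v :: l, ∃ y ∈ v :: l, x ≠ y ∧ G.adj x c ∧ G.adj y c := by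
  induction l generalizing v with
  | nil =>
    subst ht
    exact ⟨.nil, by simp⟩
  | cons w l ih =>
    rw [List.isChain_cons_cons] at hch
    rw [List.nodup_cons] at hnd
    rw [List.getLast_cons (List.cons_ne_nil _ _)] at ht
    obtain ⟨q, hq, hlen, hsupp, hc⟩ :=
      ih (fun x hx => hl x (List.mem_cons_of_mem _ hx)) hch.2 hnd.2 ht
    obtain ⟨hne, c, hvc, hwc⟩ := hch.1
    have hvq : Sum.inl v ∉ q.support := fun h => hnd.1 ((hsupp v).1 h)
    have hcq : Sum.inr c ∉ q.support := by
      intro h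
      obtain ⟨x, hx, y, hy, hxy, hxc, hyc⟩ := hc c h
      rcases hS.eq_or_eq (hl x (List.mem_cons_of_mem _ hx)) (hl y (List.mem_cons_of_mem _ hy))
        (hl v List.mem_cons_self) hxc hyc hvc hxy with rfl | rfl
      exacts [hnd.1 hx, hnd.1 hy]
    have h1 : G.graph.Adj (Sum.inl v) (Sum.inr c) := hvc
    have h2 : G.graph.Adj (Sum.inr c) (Sum.inl w) := hwc
    refine ⟨.cons h1 (.cons h2 q), ?_, ?_, ?_, ?_⟩
    · rw [SimpleGraph.Walk.cons_isPath_iff, SimpleGraph.Walk.cons_isPath_iff]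
      refine ⟨⟨hq, hcq⟩, ?_⟩
      simpa using hvq
    · simp only [SimpleGraph.Walk.length_cons, List.length_cons, hlen]
      ring
    · simp [hsupp]
    · intro d hd
      simp only [SimpleGraph.Walk.support_cons, List.mem_cons, reduceCtorEq, false_or,
        Sum.inr.injEq] at hd
      rcases hd with rfl | hd
      · exact ⟨v, by simp, w, by simp, hne, hvc, hwc⟩
      · obtain ⟨x, hx, y, hy, h⟩ := hc d hd
        exact ⟨x, List.mem_cons_of_mem _ hx, y, List.mem_cons_of_mem _ hy, h⟩

theorem IsCycleList.exists_cycle (hS : G.IsElementary S) {s : L} {l : List L}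
    (h : G.IsCycleList s l) (hl : ∀ x ∈ s :: l, x ∈ S) :
    ∃ (u : L ⊕ R) (w : G.graph.Walk u u), w.IsCycle ∧ w.length = 2 * (l.length + 1) ∧
      ∀ x, Sum.inl x ∈ w.support ↔ x ∈ s :: l := by
  obtain ⟨hnd, hch, hlast, h2⟩ := h
  obtain _ | ⟨v, l⟩ := l
  · simp at h2
  rw [List.isChain_cons_cons] at hch
  rw [List.nodup_cons] at hnd
  have hl' : ∀ x ∈ v :: l, x ∈ S := fun x hx => hl x (List.mem_cons_of_mem _ hx)
  rw [List.getLast_cons (List.cons_ne_nil _ _)] at hlast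
  obtain ⟨t, ht⟩ : ∃ t, (v :: l).getLast (List.cons_ne_nil _ _) = t := ⟨_, rfl⟩
  obtain ⟨q, hq, hlen, hsupp, hc⟩ := exists_path_of_list hS hl' hch.2 hnd.2 ht
  rw [ht] at hlast
  have htl : t ∈ v :: l := ht ▸ List.getLast_mem _
  have htv : t ≠ v := by
    intro htv
    obtain _ | ⟨w, l⟩ := l
    · simp at h2
    rw [← ht, List.getLast_cons (List.cons_ne_nil _ _)] at htv
    exact (List.nodup_cons.1 hnd.2).1 (htv ▸ List.getLast_mem _)
  obtain ⟨⟨hsv, c, hsc, hvc⟩, -⟩ := hch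
  obtain ⟨hts, d, htd, hsd⟩ := hlast
  have hnotq : ∀ c, G.adj s c → Sum.inr c ∉ q.support := by
    intro c hsc h
    obtain ⟨x, hx, y, hy, hxy, hxc, hyc⟩ := hc c h
    rcases hS.eq_or_eq (hl' x hx) (hl' y hy) (hl s List.mem_cons_self) hxc hyc hsc hxy with
      rfl | rfl
    exacts [hnd.1 hx, hnd.1 hy]
  -- A common check would have the three neighbours `s`, `v`, `t` in `S`.
  have hdc : d ≠ c := by
    rintro rfl
    rcases hS.eq_or_eq (hl s List.mem_cons_self) (hl' v List.mem_cons_self) (hl' t htl) hsc hvc htd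
      hsv with h | h
    exacts [hts h, htv h]
  have hsq : Sum.inl s ∉ q.support := fun h => hnd.1 ((hsupp s).1 h)
  have a1 : G.graph.Adj (Sum.inl t) (Sum.inr d) := htd
  have a2 : G.graph.Adj (Sum.inr d) (Sum.inl s) := hsd
  have a3 : G.graph.Adj (Sum.inl s) (Sum.inr c) := hsc
  have a4 : G.graph.Adj (Sum.inr c) (Sum.inl v) := hvc
  refine ⟨Sum.inl t, .cons a1 (.cons a2 (.cons a3 (.cons a4 q))), ?_, ?_, fun x => ?_⟩
  · have hdq := hnotq d hsd
    have hcq := hnotq c hsc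
    have hdq' : s(Sum.inl t, Sum.inr d) ∉ q.edges :=
      fun h => hdq (q.snd_mem_support_of_mem_edges h)
    simp [SimpleGraph.Walk.cons_isCycle_iff, SimpleGraph.Walk.cons_isPath_iff, hq, hdq, hcq, hsq,
      hdc, hdq', hts]
  · simp only [SimpleGraph.Walk.length_cons, List.length_cons, hlen]
    ring
  · simp only [SimpleGraph.Walk.support_cons, List.mem_cons, reduceCtorEq, false_or,
      Sum.inl.injEq, hsupp]
    constructor
    · rintro (rfl | h)
      · exact Or.inr (List.mem_cons.1 htl)
      · exact h
    · exact Or.inr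

/-! ### Consequences of the girth -/

theorem isLinear_of_girth (hg : 4 < G.graph.girth) : G.IsLinear := by
  intro u w c d huw huc hwc hud hwd
  by_contra hcd
  have a1 : G.graph.Adj (Sum.inl u) (Sum.inr c) := huc
  have a2 : G.graph.Adj (Sum.inr c) (Sum.inl w) := hwc
  have a3 : G.graph.Adj (Sum.inl w) (Sum.inr d) := hwd
  have a4 : G.graph.Adj (Sum.inr d) (Sum.inl u) := hud
  have hcyc : (SimpleGraph.Walk.cons a1 (.cons a2 (.cons a3 (.cons a4 .nil)))).IsCycle := by
    simp [SimpleGraph.Walk.cons_isCycle_iff, SimpleGraph.Walk.cons_isPath_iff, huw, huw.symm, hcd]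
  have := SimpleGraph.girth_le_length hcyc
  simp at this
  omega

/-- A triangle of the normal graph gives a 6-cycle. Elementarity excludes the triangles formed by
three nodes at one check, which give no such cycle. -/
theorem not_adj_of_girth (hg : 6 < G.graph.girth) (hS : G.IsElementary S) {u v w : L} (hu : u ∈ S)
    (hv : v ∈ S) (hw : w ∈ S) (huv : G.normal.Adj u v) (hvw : G.normal.Adj v w) :
    ¬ G.normal.Adj u w := by
  intro huw
  have h : G.IsCycleList u [v, w] :=
    ⟨by simp [huv.ne, hvw.ne, huw.ne], by simp [huv, hvw], by simpa using huw.symm, le_rfl⟩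
  obtain ⟨_, p, hp, hlen, -⟩ := h.exists_cycle hS (by simp [hu, hv, hw])
  have := SimpleGraph.girth_le_length hp
  simp at hlen
  omega

end TannerGraph

/-! ### Growth under embeddings of vertex sets -/

theorem Grows.map {V W : Type} [DecidableEq V] [DecidableEq W] {K : SimpleGraph W} (f : V ↪ W)
    {A B : Finset V} (h : Grows (K.comap f) A B) : Grows K (A.map f) (B.map f) := by
  induction h with
  | refl => exact .refl
  | step v x y _ hv hx hy hxy hvx hvy ih =>
    rw [Finset.map_insert]
    exact ih.step (f v) (f x) (f y) (by simpa using hv) (by simpa using hx) (by simpa using hy)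
      (f.injective.ne hxy) hvx hvy

theorem Grows.exists_map {V W : Type} [DecidableEq V] [DecidableEq W] {K : SimpleGraph W}
    (f : V ↪ W) {A : Finset V} {B' : Finset W} (h : Grows K (A.map f) B')
    (hB' : ∀ x ∈ B', x ∈ Set.range f) : ∃ B, B.map f = B' ∧ Grows (K.comap f) A B := by
  induction h with
  | refl => exact ⟨A, rfl, .refl⟩
  | step v x y _ hv hx hy hxy hvx hvy ih =>
    obtain ⟨B, rfl, hB⟩ := ih fun x hx => hB' x (Finset.mem_insert_of_mem hx)
    obtain ⟨v, rfl⟩ := hB' v (Finset.mem_insert_self _ _)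
    obtain ⟨x, hx', rfl⟩ := Finset.mem_map.1 hx
    obtain ⟨y, hy', rfl⟩ := Finset.mem_map.1 hy
    exact ⟨Insert.insert v B, Finset.map_insert _ _ _, hB.step v x y
      (fun h => hv (Finset.mem_map_of_mem _ h)) hx' hy' (fun h => hxy (h ▸ rfl)) hvx hvy⟩

/-! ### Layered supersets of cycles in terms of the normal graph -/

namespace TannerGraph

variable {L R : Type} {G : TannerGraph L R} {S A C : Finset L}

/-- The normal graph on the variable nodes in `S`. -/
def normalOn (G : TannerGraph L R) (S : Finset L) : SimpleGraph {v // v ∈ S} :=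
  G.normal.comap (Function.Embedding.subtype (· ∈ S))

theorem linked_of_isChain {v : L} {l : List L} (hl : ∀ x ∈ v :: l, x ∈ A)
    (hch : (v :: l).IsChain G.normal.Adj) {x : L} (hx : x ∈ v :: l) : G.Linked A v x := by
  induction l generalizing v with
  | nil =>
    obtain rfl := List.mem_singleton.1 hx
    exact .refl
  | cons w l ih =>
    rw [List.isChain_cons_cons] at hch
    rcases List.mem_cons.1 hx with rfl | hx
    · exact .refl
    · exact .head ⟨hl v (by simp), hl w (by simp), hch.1⟩
        (ih (fun x hx => hl x (List.mem_cons_of_mem _ hx)) hch.2 hx)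

/-- Each node has its predecessor and successor as neighbours, distinct because there are at least
three nodes. -/
theorem IsCycleList.isSolid [DecidableEq L] {s : L} {l : List L} (h : G.IsCycleList s l) :
    G.IsSolid (s :: l).toFinset := by
  obtain ⟨hnd, hch, hlast, h2⟩ := h
  refine ⟨⟨s, by simp, fun v hv => linked_of_isChain (fun x hx => List.mem_toFinset.2 hx) hch
    (List.mem_toFinset.1 hv)⟩, fun v hv => ?_⟩
  simp only [List.mem_toFinset] at hv ⊢
  rcases List.mem_cons.1 hv with rfl | hv
  · obtain _ | ⟨w, l⟩ := l
    · simp at h2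
    rw [List.getLast_cons (List.cons_ne_nil _ _)] at hlast
    refine ⟨w, by simp, _, List.mem_cons_of_mem _ (List.getLast_mem (List.cons_ne_nil w l)), ?_,
      (List.isChain_cons_cons.1 hch).1, hlast.symm⟩
    obtain _ | ⟨x, l⟩ := l
    · simp at h2
    rw [List.getLast_cons (List.cons_ne_nil _ _)]
    intro h
    exact (List.nodup_cons.1 (List.nodup_cons.1 hnd).2).1 (h ▸ List.getLast_mem _)
  · obtain ⟨a, b, rfl⟩ := List.append_of_mem hv
    rw [← List.cons_append] at hch hnd
    have hpred : G.normal.Adj ((s :: a).getLast (List.cons_ne_nil _ _)) v :=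
      (List.isChain_append.1 hch).2.2 _ (List.getLast_mem_getLast? _) v (by simp)
    have hmem : (s :: a).getLast (List.cons_ne_nil _ _) ∈ s :: a := List.getLast_mem _
    refine ⟨_, List.mem_append_left _ hmem, ?_⟩
    have hdisj := (List.nodup_append.1 hnd).2.2
    obtain _ | ⟨w, b⟩ := b
    · refine ⟨s, by simp, fun h => ?_, hpred.symm, by simpa using hlast⟩
      obtain _ | ⟨x, a⟩ := a
      · simp at h2
      rw [List.getLast_cons (List.cons_ne_nil _ _)] at h
      have hs := (List.nodup_cons.1 (List.nodup_append.1 hnd).1).1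
      exact hs (h ▸ List.getLast_mem _)
    · refine ⟨w, by simp, hdisj _ hmem w (by simp), hpred.symm, ?_⟩
      exact (List.isChain_cons_cons.1 (List.isChain_append.1 hch).2.1).1

/-- Cycles of the Tanner graph become cycle lists of half the length, LSS sequences become growth,
and both restrict to `S` because growth only enlarges the starting set. -/
theorem setOf_cycle_lss [DecidableEq L] (hG : G.IsLinear) (hS : G.IsElementary S) :
    {y : ℕ | ∃ C : Finset L, G.IsCycleSet C y ∧ G.IsLSS C S} =
      (2 * ·) '' fillLengths (G.normalOn S) := by
  have huniv : (Finset.univ : Finset {v // v ∈ S}).map (Function.Embedding.subtype (· ∈ S)) = S :=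
    Finset.attach_map_val
  have hlist : ∀ l : List {v // v ∈ S},
      l.toFinset.map (Function.Embedding.subtype (· ∈ S)) = (l.map Subtype.val).toFinset := by
    intro l
    ext x
    simp
  have hcyc : ∀ (s : {v // v ∈ S}) (l : List {v // v ∈ S}),
      (Grows G.normal (s.1 :: l.map Subtype.val).toFinset S ∧
        G.IsCycleList s.1 (l.map Subtype.val)) ↔
      IsFillingCycle (G.normalOn S) s l ∧ 2 ≤ l.length := by
    intro s l
    have h1 : (s.1 :: l.map Subtype.val).Nodup ↔ (s :: l).Nodup := by
      rw [← List.map_cons, List.nodup_map_iff Subtype.val_injective]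
    have h2 : (s.1 :: l.map Subtype.val).IsChain G.normal.Adj ↔
        (s :: l).IsChain (G.normalOn S).Adj := by
      rw [← List.map_cons, List.isChain_map]
      rfl
    have h3 : (s.1 :: l.map Subtype.val).getLast (List.cons_ne_nil _ _) =
        ((s :: l).getLast (List.cons_ne_nil _ _)).1 := by
      simp only [← List.map_cons]
      rw [List.getLast_map]
    have h4 : Grows G.normal (s.1 :: l.map Subtype.val).toFinset S ↔
        Grows (G.normalOn S) (s :: l).toFinset Finset.univ := by
      rw [← List.map_cons, ← hlist]
      constructor
      · intro h
        obtain ⟨B, hB, hg⟩ := h.exists_map _ fun x hx => ⟨⟨x, hx⟩, rfl⟩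
        obtain rfl : B = Finset.univ := Finset.map_injective _ (hB.trans huniv.symm)
        exact hg
      · intro h
        have := h.map (K := G.normal) (Function.Embedding.subtype (· ∈ S))
        rwa [huniv] at this
    constructor
    · rintro ⟨hg, ha, hb, hc, hd⟩
      rw [h3] at hc
      exact ⟨⟨h1.1 ha, h2.1 hb, hc, h4.1 hg⟩, by simpa using hd⟩
    · rintro ⟨⟨ha, hb, hc, hg⟩, hd⟩
      exact ⟨h4.2 hg, h1.2 ha, h2.2 hb, by rw [h3]; exact hc, by simpa using hd⟩
  ext y
  constructor
  · rintro ⟨C, ⟨u, w, hw, rfl, hC⟩, hlss⟩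
    obtain ⟨s, l, hsl, hlen, hsupp⟩ := exists_cycleList hG hw
    obtain rfl : C = (s :: l).toFinset := by
      ext x
      rw [hC, hsupp, List.mem_toFinset]
    have hg := hlss.grows hG
    have hmem : ∀ x ∈ s :: l, x ∈ S := fun x hx => hg.subset (List.mem_toFinset.2 hx)
    lift l to List {v // v ∈ S} using fun x hx => hmem x (List.mem_cons_of_mem _ hx)
    lift s to {v // v ∈ S} using hmem s List.mem_cons_self
    obtain ⟨h1, h2⟩ := (hcyc s l).1 ⟨hg, hsl⟩
    exact ⟨l.length + 1, ⟨by omega, s, l, h1, rfl⟩, by simpa using hlen.symm⟩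
  · rintro ⟨k, ⟨hk, s, l, h, rfl⟩, rfl⟩
    obtain ⟨hg, hsl⟩ := (hcyc s l).2 ⟨h, by omega⟩
    obtain ⟨u, w, hw, hlen, hsupp⟩ :=
      hsl.exists_cycle hS fun x hx => hg.subset (List.mem_toFinset.2 hx)
    refine ⟨_, ⟨u, w, hw, by simpa using hlen, fun x => ?_⟩, (isLSS_of_grows hG hS hsl.isSolid hg).1⟩
    rw [hsupp, List.mem_toFinset]

end TannerGraph

namespace TannerGraph

/-! ### The induced subgraph is determined by the normal graph -/

variable {L R L' R' : Type} {G : TannerGraph L R} {S : Finset L} {G' : TannerGraph L' R'}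
  {S' : Finset L'}

/-- The variable node `v` as a vertex of the induced subgraph. -/
def varNode (G : TannerGraph L R) (S : Finset L) (v : {v // v ∈ S}) : G.nodes S :=
  ⟨Sum.inl v.1, Or.inl ⟨v.1, v.2, rfl⟩⟩

/-- The check node `c` as a vertex of the induced subgraph. -/
def checkNode (G : TannerGraph L R) (S : Finset L) (c : {c // c ∈ G.checks S}) : G.nodes S :=
  ⟨Sum.inr c.1, Or.inr ⟨c.1, c.2, rfl⟩⟩

theorem varNode_injective : Function.Injective (G.varNode S) := fun _ _ h =>
  Subtype.ext (Sum.inl_injective (congrArg Subtype.val h))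

theorem checkNode_injective : Function.Injective (G.checkNode S) := fun _ _ h =>
  Subtype.ext (Sum.inr_injective (congrArg Subtype.val h))

theorem varNode_or_checkNode (x : G.nodes S) :
    (∃ v, x = G.varNode S v) ∨ ∃ c, x = G.checkNode S c := by
  obtain ⟨_, ⟨v, hv, rfl⟩ | ⟨c, hc, rfl⟩⟩ := x
  exacts [Or.inl ⟨⟨v, hv⟩, rfl⟩, Or.inr ⟨⟨c, hc⟩, rfl⟩]

theorem varNode_adj (v : {v // v ∈ S}) (x : G.nodes S) :
    (G.inducedSubgraph S).Adj (G.varNode S v) x ↔ ∃ c, x = G.checkNode S c ∧ G.adj v c := by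
  constructor
  · intro h
    rcases varNode_or_checkNode x with ⟨w, rfl⟩ | ⟨c, rfl⟩
    · exact h.elim
    · exact ⟨c, rfl, h⟩
  · rintro ⟨c, rfl, h⟩
    exact h

theorem checkNode_adj (c : {c // c ∈ G.checks S}) (x : G.nodes S) :
    (G.inducedSubgraph S).Adj (G.checkNode S c) x ↔ ∃ v, x = G.varNode S v ∧ G.adj v c := by
  constructor
  · intro h
    rcases varNode_or_checkNode x with ⟨w, rfl⟩ | ⟨c, rfl⟩
    · exact ⟨w, rfl, h⟩
    · exact h.elim
  · rintro ⟨c, rfl, h⟩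
    exact h

theorem normalOn_adj_iff (u w : {v // v ∈ S}) :
    (G.normalOn S).Adj u w ↔ u ≠ w ∧ ∃ x, (G.inducedSubgraph S).Adj (G.varNode S u) x ∧
      (G.inducedSubgraph S).Adj (G.varNode S w) x := by
  simp only [varNode_adj]
  constructor
  · rintro ⟨h, c, hu, hw⟩
    exact ⟨fun h' => h (congrArg _ h'), _, ⟨⟨c, u, u.2, hu⟩, rfl, hu⟩, ⟨⟨c, u, u.2, hu⟩, rfl, hw⟩⟩
  · rintro ⟨h, _, ⟨c, rfl, hu⟩, d, hcd, hw⟩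
    obtain rfl := checkNode_injective hcd
    exact ⟨fun h' => h (Subtype.ext h'), c, hu, hw⟩

/-- The isomorphism is not assumed to respect the two sides, but a variable node has four neighbours
in the induced subgraph and a check at most two. -/
theorem exists_eq_varNode (hG : G.LeftRegular 4) (hS' : G'.IsElementary S')
    (f : G.inducedSubgraph S ≃g G'.inducedSubgraph S') (v : {v // v ∈ S}) :
    ∃ w, f (G.varNode S v) = G'.varNode S' w := by
  rcases varNode_or_checkNode (f (G.varNode S v)) with h | ⟨c, hc⟩
  · exact h
  have key : ∀ d (hd : G.adj v d), ∃ w : {w // w ∈ S'}, G'.adj w c ∧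
      f (G.checkNode S ⟨d, v, v.2, hd⟩) = G'.varNode S' w := by
    intro d hd
    have h := f.map_adj_iff.2 ((varNode_adj v _).2 ⟨⟨d, v, v.2, hd⟩, rfl, hd⟩)
    rw [hc, checkNode_adj] at h
    obtain ⟨w, hw, hwc⟩ := h
    exact ⟨w, hwc, hw⟩
  obtain ⟨a, b, d, ha, hb, hd, hab, had, hbd⟩ := Set.two_lt_ncard_iff
    (Set.finite_of_ncard_ne_zero (by rw [hG v]; norm_num)) |>.1 (by rw [hG v]; norm_num)
  obtain ⟨x, hx, hfx⟩ := key a ha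
  obtain ⟨y, hy, hfy⟩ := key b hb
  obtain ⟨z, hz, hfz⟩ := key d hd
  have hne : ∀ {a b} (ha : G.adj v a) (hb : G.adj v b) {x y : {w // w ∈ S'}},
      f (G.checkNode S ⟨a, v, v.2, ha⟩) = G'.varNode S' x →
      f (G.checkNode S ⟨b, v, v.2, hb⟩) = G'.varNode S' y → a ≠ b → x.1 ≠ y.1 := by
    intro a b ha hb x y hx hy hab hxy
    obtain rfl : x = y := Subtype.ext hxy
    exact hab (congrArg Subtype.val (checkNode_injective (f.injective (hx.trans hy.symm))))
  rcases hS'.eq_or_eq x.2 y.2 z.2 hx hy hz (hne ha hb hfx hfy hab) with h | h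
  · exact absurd h.symm (hne ha hd hfx hfz had)
  · exact absurd h.symm (hne hb hd hfy hfz hbd)

/-- Being joined in the normal graph means having a common neighbour in the induced subgraph. -/
theorem normalOn_iso_of_induced (hG : G.LeftRegular 4) (hG' : G'.LeftRegular 4)
    (hS : G.IsElementary S) (hS' : G'.IsElementary S')
    (f : G.inducedSubgraph S ≃g G'.inducedSubgraph S') :
    Nonempty (G.normalOn S ≃g G'.normalOn S') := by
  choose φ hφ using exists_eq_varNode hG hS' f
  have hinj : Function.Injective φ := fun v w h =>
    varNode_injective (f.injective (by rw [hφ, hφ, h]))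
  have hsurj : Function.Surjective φ := by
    intro w
    obtain ⟨v, hv⟩ := exists_eq_varNode hG' hS f.symm w
    refine ⟨v, varNode_injective (G := G') ?_⟩
    rw [← hφ, ← hv]
    exact f.apply_symm_apply _
  refine ⟨⟨Equiv.ofBijective φ ⟨hinj, hsurj⟩, fun {u w} => ?_⟩⟩
  change (G'.normalOn S').Adj (φ u) (φ w) ↔ _
  rw [normalOn_adj_iff, normalOn_adj_iff,
    hinj.ne_iff, ← hφ, ← hφ, f.surjective.exists]
  simp only [f.map_adj_iff]

/-- The neighbours in `S` of a check node. -/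
def checkNbrs (G : TannerGraph L R) (S : Finset L) (c : R) : Set {v // v ∈ S} := {v | G.adj v c}

theorem IsElementary.checkNbrs_cases (hS : G.IsElementary S) {c : R} (hc : c ∈ G.checks S) :
    (∃ v, G.checkNbrs S c = {v}) ∨ ∃ u w, u ≠ w ∧ G.checkNbrs S c = {u, w} := by
  obtain ⟨v, hv, hvc⟩ := hc
  by_cases h : ∃ w : {v // v ∈ S}, ⟨v, hv⟩ ≠ w ∧ G.adj w c
  · obtain ⟨w, hvw, hwc⟩ := h
    refine Or.inr ⟨⟨v, hv⟩, w, hvw, ?_⟩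
    ext x
    constructor
    · intro hx
      rcases hS.eq_or_eq hv w.2 x.2 hvc hwc hx fun h => hvw (Subtype.ext h) with h | h
      exacts [Or.inl (Subtype.ext h), Or.inr (Subtype.ext h)]
    · rintro (rfl | rfl)
      exacts [hvc, hwc]
  · push Not at h
    refine Or.inl ⟨⟨v, hv⟩, ?_⟩
    ext x
    constructor
    · intro hx
      by_contra hne
      exact h x (Ne.symm hne) hx
    · rintro rfl
      exact hvc

/-- The check nodes with a given set of neighbours in `S`. -/
def fiber (G : TannerGraph L R) (S : Finset L) (A : Set {v // v ∈ S}) : Set R :=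
  {c | c ∈ G.checks S ∧ G.checkNbrs S c = A}

theorem fiber_singleton (hS : G.IsElementary S) (v : {v // v ∈ S}) :
    G.fiber S {v} = {c | c ∈ G.unsatisfied S ∧ G.adj v c} := by
  ext c
  constructor
  · rintro ⟨-, hc⟩
    have hvc : v ∈ G.checkNbrs S c := hc ▸ rfl
    refine ⟨(hS.mem_unsatisfied_iff v.2 hvc).2 fun w hw hwc => ?_, hvc⟩
    have : (⟨w, hw⟩ : {v // v ∈ S}) ∈ G.checkNbrs S c := hwc
    rw [hc] at this
    exact congrArg Subtype.val this
  · rintro ⟨hc, hvc⟩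
    refine ⟨hc.1, Set.eq_singleton_iff_unique_mem.2 ⟨hvc, fun w hw => ?_⟩⟩
    exact Subtype.ext ((hS.mem_unsatisfied_iff v.2 hvc).1 hc w w.2 hw)

/-- The right side is 1 or 0 according to adjacency, written as a cardinality so that a graph
isomorphism can rewrite it. -/
theorem ncard_fiber_pair (hG : G.IsLinear) (hS : G.IsElementary S) {u w : {v // v ∈ S}}
    (huw : u ≠ w) : (G.fiber S {u, w}).ncard = {_x : Unit | (G.normalOn S).Adj u w}.ncard := by
  by_cases h : (G.normalOn S).Adj u w
  · simp only [h, Set.ofPred_true, Set.ncard_univ, Nat.card_unique, Set.ncard_eq_one]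
    obtain ⟨-, c, huc, hwc⟩ := h
    refine ⟨c, Set.eq_singleton_iff_unique_mem.2 ⟨⟨⟨u, u.2, huc⟩, ?_⟩, ?_⟩⟩
    · ext x
      constructor
      · intro hx
        rcases hS.eq_or_eq u.2 w.2 x.2 huc hwc hx fun h => huw (Subtype.ext h) with h | h
        exacts [Or.inl (Subtype.ext h), Or.inr (Subtype.ext h)]
      · rintro (rfl | rfl)
        exacts [huc, hwc]
    · rintro d ⟨-, hd⟩
      have hud : u ∈ G.checkNbrs S d := hd ▸ Or.inl rfl
      have hwd : w ∈ G.checkNbrs S d := hd ▸ Or.inr rfl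
      exact hG _ _ _ _ (fun h => huw (Subtype.ext h)) hud hwd huc hwc
  · have h0 : G.fiber S {u, w} = ∅ := by
      rw [Set.eq_empty_iff_forall_notMem]
      rintro d ⟨-, hd⟩
      have hud : u ∈ G.checkNbrs S d := hd ▸ Or.inl rfl
      have hwd : w ∈ G.checkNbrs S d := hd ▸ Or.inr rfl
      exact h ⟨fun h => huw (Subtype.ext h), d, hud, hwd⟩
    simp [h0, h]

theorem ncard_nbrs_eq (v : {v // v ∈ S}) : {w : L | w ∈ S ∧ G.normal.Adj v w}.ncard =
    ((G.normalOn S).neighborSet v).ncard := by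
  rw [← Set.ncard_image_of_injective _ Subtype.val_injective]
  congr 1
  ext w
  constructor
  · rintro ⟨hw, h⟩
    exact ⟨⟨w, hw⟩, h, rfl⟩
  · rintro ⟨w, h, rfl⟩
    exact ⟨w.2, h⟩

/-- A singleton is the neighbourhood of d - deg v checks, a pair of one or none according to
adjacency, and other sets do not occur. All these numbers are invariants of the normal graph. -/
theorem ncard_fiber_image [Finite R] [Finite R'] {d : ℕ} (hd : G.LeftRegular d)
    (hd' : G'.LeftRegular d) (hG : G.IsLinear) (hG' : G'.IsLinear)
    (hS : G.IsElementary S) (hS' : G'.IsElementary S') (φ : G.normalOn S ≃g G'.normalOn S')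
    (A : Set {v // v ∈ S}) : (G.fiber S A).ncard = (G'.fiber S' (φ '' A)).ncard := by
  by_cases h1 : ∃ v, A = {v}
  · obtain ⟨v, rfl⟩ := h1
    rw [Set.image_singleton, fiber_singleton hS, fiber_singleton hS']
    have e1 := ncard_unsatisfied_add hd hG hS v.2
    have e2 := ncard_unsatisfied_add hd' hG' hS' (φ v).2
    rw [ncard_nbrs_eq] at e1 e2
    have e3 : ((G'.normalOn S').neighborSet (φ v)).ncard = ((G.normalOn S).neighborSet v).ncard := by
      rw [← Set.ncard_image_of_injective _ φ.injective]
      congr 1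
      ext w
      constructor
      · intro hw
        refine ⟨φ.symm w, φ.map_adj_iff.1 ?_, φ.apply_symm_apply w⟩
        rw [φ.apply_symm_apply]
        exact hw
      · rintro ⟨w, hw, rfl⟩
        exact φ.map_adj_iff.2 hw
    omega
  by_cases h2 : ∃ u w, u ≠ w ∧ A = {u, w}
  · obtain ⟨u, w, huw, rfl⟩ := h2
    rw [Set.image_pair, ncard_fiber_pair hG hS huw, ncard_fiber_pair hG' hS' (φ.injective.ne huw)]
    simp only [φ.map_adj_iff]
  · have e1 : G.fiber S A = ∅ := by
      rw [Set.eq_empty_iff_forall_notMem]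
      rintro c ⟨hc, rfl⟩
      rcases hS.checkNbrs_cases hc with h | h
      exacts [h1 h, h2 h]
    have e2 : G'.fiber S' (φ '' A) = ∅ := by
      rw [Set.eq_empty_iff_forall_notMem]
      rintro c ⟨hc, hcA⟩
      have hA : A = φ.symm '' (G'.checkNbrs S' c) := by
        rw [hcA, Set.image_image]
        simp
      rcases hS'.checkNbrs_cases hc with ⟨v, h⟩ | ⟨u, w, huw, h⟩
      · exact h1 ⟨φ.symm v, by rw [hA, h, Set.image_singleton]⟩
      · exact h2 ⟨φ.symm u, φ.symm w, φ.symm.injective.ne huw, by rw [hA, h, Set.image_pair]⟩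
    rw [e1, e2, Set.ncard_empty, Set.ncard_empty]

/-- The vertices of the induced subgraph. -/
noncomputable def nodesEquiv (G : TannerGraph L R) (S : Finset L) :
    {v // v ∈ S} ⊕ {c // c ∈ G.checks S} ≃ G.nodes S :=
  Equiv.ofBijective (Sum.elim (G.varNode S) (G.checkNode S))
    ⟨varNode_injective.sumElim checkNode_injective fun _ _ h =>
      Sum.inl_ne_inr (congrArg Subtype.val h), fun x => by
        rcases varNode_or_checkNode x with ⟨v, rfl⟩ | ⟨c, rfl⟩
        exacts [⟨Sum.inl v, rfl⟩, ⟨Sum.inr c, rfl⟩]⟩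

/-- Checks matter only through their neighbourhoods in `S`. Corresponding neighbourhoods occur
equally often, so bijections between the fibres assemble to a bijection of checks compatible with
`φ`. -/
theorem induced_iso_of_normalOn [Finite R] [Finite R'] {d : ℕ} (hd : G.LeftRegular d)
    (hd' : G'.LeftRegular d) (hG : G.IsLinear) (hG' : G'.IsLinear)
    (hS : G.IsElementary S) (hS' : G'.IsElementary S') (φ : G.normalOn S ≃g G'.normalOn S') :
    Nonempty (G.inducedSubgraph S ≃g G'.inducedSubgraph S') := by
  have hfib : ∀ A : Set {v // v ∈ S'},
      Nonempty ({c : {c // c ∈ G.checks S} // φ '' G.checkNbrs S c = A} ≃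
        {c : {c // c ∈ G'.checks S'} // G'.checkNbrs S' c = A}) := by
    intro A
    have e1 : Nat.card {c : {c // c ∈ G.checks S} // φ '' G.checkNbrs S c = A} =
        (G.fiber S (φ.symm '' A)).ncard := by
      rw [← Nat.card_coe_set_eq]
      refine Nat.card_congr ((Equiv.subtypeSubtypeEquivSubtypeInter _
        fun c => φ '' G.checkNbrs S c = A).trans (Equiv.subtypeEquivRight fun c => ?_))
      refine and_congr_right fun _ => ?_
      constructor
      · rintro rfl
        rw [Set.image_image]
        simp
      · intro h
        rw [h, Set.image_image]
        simp
    have e2 : Nat.card {c : {c // c ∈ G'.checks S'} // G'.checkNbrs S' c = A} =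
        (G'.fiber S' A).ncard := by
      rw [← Nat.card_coe_set_eq]
      exact Nat.card_congr (Equiv.subtypeSubtypeEquivSubtypeInter _
        fun c => G'.checkNbrs S' c = A)
    refine Finite.card_eq.1 ?_
    rw [e1, e2, ncard_fiber_image hd hd' hG hG' hS hS' φ, Set.image_image]
    simp
  let ψ : {c // c ∈ G.checks S} ≃ {c // c ∈ G'.checks S'} :=
    Equiv.ofFiberEquiv fun A => (hfib A).some
  have hψ : ∀ c, G'.checkNbrs S' (ψ c) = φ '' G.checkNbrs S c := fun c =>
    Equiv.ofFiberEquiv_map (fun A => (hfib A).some) c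
  have hadj : ∀ v c, G'.adj (φ v) (ψ c) ↔ G.adj v c := by
    intro v c
    have : φ v ∈ G'.checkNbrs S' (ψ c) ↔ v ∈ G.checkNbrs S c := by
      rw [hψ, φ.injective.mem_set_image]
    exact this
  refine ⟨⟨(G.nodesEquiv S).symm.trans ((Equiv.sumCongr φ.toEquiv ψ).trans (G'.nodesEquiv S')),
    fun {x y} => ?_⟩⟩
  obtain ⟨x, rfl⟩ := (G.nodesEquiv S).surjective x
  obtain ⟨y, rfl⟩ := (G.nodesEquiv S).surjective y
  simp only [Equiv.trans_apply, Equiv.symm_apply_apply]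
  rcases x with v | c <;> rcases y with w | e
  · exact Iff.rfl
  · exact hadj v e
  · exact hadj w c
  · exact Iff.rfl

end TannerGraph

namespace TannerGraph

/-! ### A Tanner graph with a given normal graph -/

section OfNormal

variable {W : Type} [Fintype W] (H : SimpleGraph W) [DecidableRel H.Adj]

/-- The Tanner graph with a check node of degree two for every edge of `H` and with check nodes of
degree one that bring the degrees of the variable nodes up to four. Further check nodes are
isolated. -/
def ofNormal : TannerGraph W (Sym2 W ⊕ W × Fin 4) where
  adj v := Sum.elim (fun e => e ∈ H.edgeSet ∧ v ∈ e) fun p => p.1 = v ∧ (p.2 : ℕ) < 4 - H.degree v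

variable {H}

theorem ofNormal_leftRegular [DecidableEq W] (hH : ∀ v, H.degree v ≤ 4) : (ofNormal H).LeftRegular 4 := by
  intro v
  have h1 : {c | (ofNormal H).adj v c} = Sum.inl '' (H.incidenceFinset v : Set (Sym2 W)) ∪
      Sum.inr '' (({v} : Finset W) ×ˢ (Finset.univ.filter fun i : Fin 4 =>
        (i : ℕ) < 4 - H.degree v) : Finset (W × Fin 4)) := by
    ext c
    rcases c with e | ⟨w, i⟩
    · simp [ofNormal, SimpleGraph.incidenceSet]
    · simp [ofNormal, and_comm, eq_comm]
  rw [h1, Set.ncard_union_eq, Set.ncard_image_of_injective _ Sum.inl_injective,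
    Set.ncard_image_of_injective _ Sum.inr_injective, Set.ncard_coe_finset, Set.ncard_coe_finset,
    Finset.card_product, Finset.card_singleton, one_mul, H.card_incidenceFinset_eq_degree,
    Fin.card_filter_val_lt]
  · have := hH v
    omega
  · rw [Set.disjoint_left]
    rintro _ ⟨e, -, rfl⟩ ⟨p, -, h⟩
    exact Sum.inr_ne_inl h

theorem ofNormal_normal : (ofNormal H).normal = H := by
  ext u w
  constructor
  · rintro ⟨huw, e | p, hu, hw⟩
    · have he := (Sym2.mem_and_mem_iff huw).1 ⟨hu.2, hw.2⟩
      have := hu.1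
      rwa [he, SimpleGraph.mem_edgeSet] at this
    · exact absurd (hu.1.symm.trans hw.1) huw
  · intro h
    exact ⟨h.ne, Sum.inl s(u, w), ⟨h, Sym2.mem_mk_left _ _⟩, ⟨h, Sym2.mem_mk_right _ _⟩⟩

theorem ofNormal_isLinear : (ofNormal H).IsLinear := by
  rintro u w (e | p) (f | q) huw huc hwc hud hwd
  · rw [(Sym2.mem_and_mem_iff huw).1 ⟨huc.2, hwc.2⟩, (Sym2.mem_and_mem_iff huw).1 ⟨hud.2, hwd.2⟩]
  · exact absurd (hud.1.symm.trans hwd.1) huw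
  · exact absurd (huc.1.symm.trans hwc.1) huw
  · exact absurd (hud.1.symm.trans hwd.1) huw

theorem ofNormal_isElementary (S : Finset W) : (ofNormal H).IsElementary S := by
  refine IsElementary.mono (S := Finset.univ) ?_ (Finset.subset_univ S)
  rintro (e | p) ⟨v, -, hv⟩
  · right
    induction e with
    | _ x y =>
      rw [checkDegree, ← Set.ncard_pair (a := x) (b := y) (SimpleGraph.Adj.ne hv.1)]
      congr 1
      ext u
      have h1 : s(x, y) ∈ H.edgeSet := hv.1
      simp only [Finset.mem_univ, true_and, ofNormal, Sum.elim_inl, h1]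
      simp
  · left
    rw [checkDegree, Set.ncard_eq_one]
    refine ⟨p.1, ?_⟩
    ext u
    constructor
    · exact fun h => h.2.1.symm
    · rintro rfl
      have h1 : p.1 = v := hv.1
      exact ⟨Finset.mem_univ _, rfl, by rw [h1]; exact hv.2⟩

/-- The 4-cycle gives a cycle of length 8; linearity rules out length 4 and triangle-freeness length
6. -/
theorem ofNormal_girth (htri : ∀ u v w, H.Adj u v → H.Adj v w → ¬ H.Adj u w) {s : W} {l : List W}
    (hl : (ofNormal H).IsCycleList s l) (hlen : l.length = 3) : (ofNormal H).graph.girth = 8 := by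
  obtain ⟨u, w, hw, hwl, -⟩ :=
    hl.exists_cycle (ofNormal_isElementary Finset.univ) fun _ _ => Finset.mem_univ _
  refine le_antisymm ?_ ?_
  · have := SimpleGraph.girth_le_length hw
    omega
  · obtain ⟨a, w', hw', hg⟩ := SimpleGraph.exists_girth_eq_length.2 fun h => h w hw
    rw [hg]
    obtain ⟨s, l, ⟨-, hch, hlast, h2⟩, hl, -⟩ := exists_cycleList ofNormal_isLinear hw'
    have h3 : l.length ≠ 2 := by
      intro h2
      match l, h2 with
      | [a, b], _ =>
        rw [ofNormal_normal] at hch hlast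
        simp only [List.isChain_cons_cons] at hch
        exact htri _ _ _ hch.1 hch.2.1 (SimpleGraph.Adj.symm hlast)
    omega

end OfNormal

end TannerGraph

/-! ### Structures from codes -/

/-- The graph with code `c`. -/
def codeGraph (n c : ℕ) : SimpleGraph (Fin n) :=
  SimpleGraph.fromRel fun i j => codeAdj c i j = true

instance (n c : ℕ) : DecidableRel (codeGraph n c).Adj :=
  inferInstanceAs (DecidableRel (SimpleGraph.fromRel fun i j : Fin n => codeAdj c i j = true).Adj)

theorem isLabelling_codeGraph {n c : ℕ} (h : codeValid n c = true) :
    IsLabelling c (codeGraph n c) (Equiv.refl (Fin n)) := by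
  intro i j
  simp only [codeValid, List.all_eq_true, List.mem_range, Bool.and_eq_true] at h
  have h1 := (h i i.2).1
  have h2 := ((h i i.2).2.2 j j.2).1
  rw [beq_iff_eq] at h2
  simp only [codeGraph, SimpleGraph.fromRel_adj, Equiv.refl_apply, h2, or_self]
  constructor
  · exact And.right
  · refine fun h3 => ⟨?_, h3⟩
    rintro rfl
    simp [h3] at h1

theorem codeGraph_triangleFree {n c : ℕ} (h : codeValid n c = true) (u v w : Fin n)
    (huv : (codeGraph n c).Adj u v) (hvw : (codeGraph n c).Adj v w) :
    ¬ (codeGraph n c).Adj u w := by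
  have hlab := isLabelling_codeGraph h
  simp only [codeValid, List.all_eq_true, List.mem_range, Bool.and_eq_true] at h
  have h1 := ((h u u.2).2.2 v v.2).2
  have h2 : codeAdj c u v = true := (hlab u v).1 huv
  simp only [h2, Bool.not_true, Bool.false_or, List.all_eq_true, Bool.not_eq_true'] at h1
  have h3 := h1 w (List.mem_filter.2 ⟨List.mem_range.2 w.2, (hlab v w).1 hvw⟩)
  intro huw
  rw [(hlab u w).1 huw] at h3
  exact absurd h3 (by decide)

theorem codeGraph_degree_le {n c : ℕ} (h : codeValid n c = true) (v : Fin n) :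
    (codeGraph n c).degree v ≤ 4 := by
  have hlab := (isLabelling_codeGraph h).length_nbrs v
  simp only [codeValid, List.all_eq_true, List.mem_range, Bool.and_eq_true, decide_eq_true_eq] at h
  have := (h v v.2).2.1
  rwa [hlab] at this

theorem degree_sum_inl {V W : Type} (H : SimpleGraph V) (K : SimpleGraph W) (v : V)
    {_ : Fintype ((H ⊕g K).neighborSet (Sum.inl v))} [Fintype (H.neighborSet v)] :
    (H ⊕g K).degree (Sum.inl v) = H.degree v := by
  rw [← SimpleGraph.card_neighborSet_eq_degree, ← SimpleGraph.card_neighborSet_eq_degree,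
    ← Nat.card_eq_fintype_card, ← Nat.card_eq_fintype_card, Nat.card_coe_set_eq,
    Nat.card_coe_set_eq, SimpleGraph.neighborSet_sum_inl,
    Set.ncard_image_of_injective _ Sum.inl_injective]

theorem degree_sum_inr {V W : Type} (H : SimpleGraph V) (K : SimpleGraph W) (w : W)
    {_ : Fintype ((H ⊕g K).neighborSet (Sum.inr w))} [Fintype (K.neighborSet w)] :
    (H ⊕g K).degree (Sum.inr w) = K.degree w := by
  rw [← SimpleGraph.card_neighborSet_eq_degree, ← SimpleGraph.card_neighborSet_eq_degree,
    ← Nat.card_eq_fintype_card, ← Nat.card_eq_fintype_card, Nat.card_coe_set_eq,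
    Nat.card_coe_set_eq, SimpleGraph.neighborSet_sum_inr,
    Set.ncard_image_of_injective _ Sum.inr_injective]

/-- The graph of the code is subdivided and supplied with leaves by `ofNormal`. A disjoint 4-cycle
outside `S` makes the girth exactly 8 even when the code has no 4-cycle. -/
theorem exists_etsIn {n c : ℕ} (hc : codeValid n c = true) (ht : codeType n c ≠ 0) :
    ∃ s : ETSIn 4 8, Realizes n c (s.G.normalOn s.S) := by
  classical
  let H : SimpleGraph (Fin n ⊕ Fin 4) := codeGraph n c ⊕g SimpleGraph.cycleGraph 4
  let G := TannerGraph.ofNormal H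
  let S : Finset (Fin n ⊕ Fin 4) := Finset.univ.map Function.Embedding.inl
  have hdeg : G.LeftRegular 4 := by
    refine TannerGraph.ofNormal_leftRegular ?_
    rintro (v | v)
    · exact (degree_sum_inl _ _ v).trans_le (codeGraph_degree_le hc v)
    · refine (degree_sum_inr _ _ v).trans_le ?_
      rw [SimpleGraph.cycleGraph_degree_three_le]
      norm_num
  have htri : ∀ u v w, H.Adj u v → H.Adj v w → ¬ H.Adj u w := by
    have h4 : ∀ u v w : Fin 4, (SimpleGraph.cycleGraph 4).Adj u v →
      (SimpleGraph.cycleGraph 4).Adj v w → ¬ (SimpleGraph.cycleGraph 4).Adj u w := by decide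
    rintro (u | u) (v | v) (w | w) huv hvw huw
    · exact codeGraph_triangleFree hc u v w huv hvw huw
    on_goal 7 => exact h4 u v w huv hvw huw
    all_goals simp [H] at huv hvw
  have hcyc : G.IsCycleList (Sum.inr 0) [Sum.inr 1, Sum.inr 2, Sum.inr 3] := by
    have h : ∀ i j : Fin 4, (SimpleGraph.cycleGraph 4).Adj i j →
        G.normal.Adj (Sum.inr i) (Sum.inr j) := by
      intro i j hij
      rw [TannerGraph.ofNormal_normal]
      exact hij
    refine ⟨by simp, ?_, h 3 0 (by decide), by simp⟩
    simp only [List.isChain_cons_cons, List.isChain_singleton, and_true]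
    exact ⟨h 0 1 (by decide), h 1 2 (by decide), h 2 3 (by decide)⟩
  let e : Fin n ≃ {v // v ∈ S} := Equiv.ofBijective
    (fun i => ⟨Sum.inl i, Finset.mem_map_of_mem _ (Finset.mem_univ i)⟩)
    ⟨fun i j h => Sum.inl_injective (congrArg Subtype.val h), by
      rintro ⟨v, hv⟩
      obtain ⟨i, -, rfl⟩ := Finset.mem_map.1 hv
      exact ⟨i, rfl⟩⟩
  have he : ∀ i j, (G.normalOn S).Adj (e i) (e j) ↔ (codeGraph n c).Adj i j := by
    intro i j
    change G.normal.Adj (Sum.inl i) (Sum.inl j) ↔ _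
    rw [TannerGraph.ofNormal_normal]
    rfl
  have hlab : IsLabelling c (G.normalOn S) e := fun i j => by
    rw [he]
    exact isLabelling_codeGraph hc i j
  have hleast := hlab.isLeast_codeType (fun u v w huv hvw => by
    obtain ⟨u, rfl⟩ := e.surjective u
    obtain ⟨v, rfl⟩ := e.surjective v
    obtain ⟨w, rfl⟩ := e.surjective w
    rw [he] at huv hvw ⊢
    exact codeGraph_triangleFree hc u v w huv hvw) ht
  have hlss := hleast.1
  rw [← TannerGraph.setOf_cycle_lss TannerGraph.ofNormal_isLinear
    (TannerGraph.ofNormal_isElementary S)] at hlss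
  -- That `S` is an ETS, and in particular connected, is read off the last term of the LSS sequence
  -- provided by the nonzero `codeType`.
  obtain ⟨C, -, m, T, -, hm, -, hT⟩ := hlss
  exact ⟨⟨_, _, inferInstance, inferInstance, G, hdeg,
    TannerGraph.ofNormal_girth htri hcyc rfl, S, hm ▸ (hT m le_rfl).2⟩, e, hlab⟩

/-! ### The count -/

set_option maxRecDepth 100000 in
theorem finalCodes_table : ∀ a < 10,
    (∀ c ∈ finalCodes a, codeValid a c = true ∧ codeType a c ≠ 0) ∧
    ∀ b < 9, ∀ x ∈ [8, 10, 12],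
      ((finalCodes a).filter fun c => codeDegSum a c + b == 4 * a && codeType a c == x).length =
        tableTS a b x ∧
      ((finalCodes a).filter fun c => codeDegSum a c + b == 4 * a &&
        (codeAbsorbing a c && codeType a c == x)).length = tableAS a b x := by
  decide +kernel

set_option maxRecDepth 100000 in
theorem graphHash_nodup : ∀ n < 10, ((finalCodes n).map (graphHash n)).Nodup := by
  decide +kernel

theorem codeType_cases {n c : ℕ} (h : codeType n c ≠ 0) :
    codeType n c = 8 ∨ codeType n c = 10 ∨ codeType n c = 12 := by
  unfold codeType at h ⊢
  split_ifs at h ⊢ <;> simp_all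

theorem tableTS_eq_zero {a b x : ℕ} (h8 : x ≠ 8) (h10 : x ≠ 10) (h12 : x ≠ 12) :
    tableTS a b x = 0 := by
  unfold tableTS
  split <;> first | rfl | contradiction

theorem tableAS_eq_zero {a b x : ℕ} (h8 : x ≠ 8) (h10 : x ≠ 10) (h12 : x ≠ 12) :
    tableAS a b x = 0 := by
  unfold tableAS
  split <;> first | rfl | contradiction

/-! ### Parameters of an ETS read off its normal graph -/

namespace ETSIn

variable (s : ETSIn 4 8)

theorem isLinear : s.G.IsLinear :=
  TannerGraph.isLinear_of_girth (by rw [s.girth_eq]; norm_num)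

theorem triangleFree (u v w : {v // v ∈ s.S}) (huv : (s.G.normalOn s.S).Adj u v)
    (hvw : (s.G.normalOn s.S).Adj v w) : ¬ (s.G.normalOn s.S).Adj u w :=
  TannerGraph.not_adj_of_girth (by rw [s.girth_eq]; norm_num) s.isETS.1 u.2 v.2 w.2 huv hvw

theorem ncard_nbrs [Fintype {v // v ∈ s.S}] [DecidableRel (s.G.normalOn s.S).Adj]
    (v : {v // v ∈ s.S}) : {w : s.L | w ∈ s.S ∧ s.G.normal.Adj v w}.ncard =
      (s.G.normalOn s.S).degree v := by
  rw [TannerGraph.ncard_nbrs_eq, Set.ncard_eq_toFinset_card', Set.toFinset_card,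
    SimpleGraph.card_neighborSet_eq_degree]

theorem ncard_unsatisfied_add [Fintype {v // v ∈ s.S}] [DecidableRel (s.G.normalOn s.S).Adj]
    (v : {v // v ∈ s.S}) : {c : s.R | c ∈ s.G.unsatisfied s.S ∧ s.G.adj v c}.ncard +
      (s.G.normalOn s.S).degree v = 4 := by
  have := s.finR
  rw [← s.ncard_nbrs]
  exact TannerGraph.ncard_unsatisfied_add s.leftRegular s.isLinear s.isETS.1 v.2

theorem unsatisfied_add_sum_degree [DecidableRel (s.G.normalOn s.S).Adj] :
    (s.G.unsatisfied s.S).ncard + ∑ v, (s.G.normalOn s.S).degree v = 4 * s.S.card := by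
  have := s.finR
  rw [TannerGraph.ncard_unsatisfied_eq_sum s.isETS.1, ← Finset.sum_coe_sort,
    ← Finset.sum_add_distrib, Finset.sum_congr rfl fun v _ => s.ncard_unsatisfied_add v]
  simp [mul_comm]

theorem two_le_degree [Fintype {v // v ∈ s.S}] [DecidableRel (s.G.normalOn s.S).Adj]
    (v : {v // v ∈ s.S}) : 2 ≤ (s.G.normalOn s.S).degree v := by
  rw [← s.ncard_nbrs, ← TannerGraph.ncard_satisfied s.isLinear s.isETS.1 v.2]
  exact s.isETS.2.2 v v.2

theorem card_pos : 0 < s.S.card := by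
  obtain ⟨_, ⟨v, hv, -⟩ | ⟨c, ⟨v, hv, -⟩, -⟩⟩ := s.isETS.2.1.nonempty
  exacts [Finset.card_pos.2 ⟨v, hv⟩, Finset.card_pos.2 ⟨v, hv⟩]

theorem exists_finalCode {a b : ℕ} (ha : a ≤ 9) (hb : b ≤ 8) (h : s.G.IsTrappingSet s.S a b) :
    ∃ c ∈ finalCodes a, Realizes a c (s.G.normalOn s.S) := by
  classical
  obtain ⟨rfl, rfl⟩ := h
  have hpos := s.card_pos
  have hsum := s.unsatisfied_add_sum_degree
  -- This matters for two vertices, where the bound on b alone does not give the required edge.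
  have h2 : s.S.card * 2 ≤ ∑ v, (s.G.normalOn s.S).degree v := by
    have := Finset.card_nsmul_le_sum Finset.univ (fun v => (s.G.normalOn s.S).degree v) 2
      fun v _ => s.two_le_degree v
    simpa using this
  obtain ⟨c, hc, e, he⟩ := exists_code ha (s.G.normalOn s.S) (Fintype.card_coe _) s.triangleFree
    (fun v => by have := s.ncard_unsatisfied_add v; omega) (by
      generalize s.S.card = n at *
      interval_cases n <;> simp only [minEdges, List.getD_cons_zero, List.getD_cons_succ] <;> omega)
  refine ⟨c, List.mem_filter.2 ⟨hc, ?_⟩, e, he⟩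
  simp only [Bool.and_eq_true, decide_eq_true_eq, List.all_eq_true, List.mem_range]
  refine ⟨hpos, ?_, fun i hi => ?_⟩
  · rw [he.degSum]
    omega
  · rw [he.length_nbrs ⟨i, hi⟩]
    exact s.two_le_degree _

variable {s}

theorem isTrappingSet_iff {a b c : ℕ} (hc : Realizes a c (s.G.normalOn s.S)) :
    s.G.IsTrappingSet s.S a b ↔ codeDegSum a c + b = 4 * a := by
  classical
  obtain ⟨e, he⟩ := hc
  have hcard : s.S.card = a := by
    rw [← Fintype.card_coe, ← Fintype.card_congr e, Fintype.card_fin]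
  have hsum := s.unsatisfied_add_sum_degree
  rw [TannerGraph.IsTrappingSet, he.degSum, and_iff_right hcard]
  omega

theorem isLSSType_iff {a c x : ℕ} (hc : Realizes a c (s.G.normalOn s.S)) (h : codeType a c ≠ 0) :
    s.G.IsLSSType s.S x ↔ codeType a c = x := by
  classical
  obtain ⟨e, he⟩ := hc
  have hl := he.isLeast_codeType s.triangleFree h
  rw [← TannerGraph.setOf_cycle_lss s.isLinear s.isETS.1] at hl
  constructor
  · exact fun h' => hl.unique h'
  · rintro rfl
    exact hl

/-- A vertex of degree d has d satisfied and 4 - d unsatisfied checks, and 4 - d < d means 3 ≤ d. -/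
theorem isAbsorbing_iff {a c : ℕ} (hc : Realizes a c (s.G.normalOn s.S)) :
    s.G.IsAbsorbing s.S ↔ codeAbsorbing a c = true := by
  classical
  obtain ⟨e, he⟩ := hc
  have key : ∀ v : {v // v ∈ s.S}, {c : s.R | c ∈ s.G.unsatisfied s.S ∧ s.G.adj v c}.ncard <
      {c : s.R | c ∈ s.G.satisfied s.S ∧ s.G.adj v c}.ncard ↔
        3 ≤ (s.G.normalOn s.S).degree v := by
    intro v
    rw [TannerGraph.ncard_satisfied s.isLinear s.isETS.1 v.2, s.ncard_nbrs]
    have := s.ncard_unsatisfied_add v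
    omega
  simp only [codeAbsorbing, List.all_eq_true, List.mem_range, decide_eq_true_eq]
  constructor
  · intro h i hi
    rw [he.length_nbrs ⟨i, hi⟩, ← key]
    exact h _ (e ⟨i, hi⟩).2
  · intro h v hv
    rw [key ⟨v, hv⟩]
    have := h _ (e.symm ⟨v, hv⟩).2
    rwa [he.length_nbrs, e.apply_symm_apply] at this

end ETSIn

/-! ### Counting structures by codes -/

theorem Realizes.of_iso {V W : Type} {H : SimpleGraph V} {K : SimpleGraph W} {n c : ℕ}
    (h : Realizes n c H) (f : H ≃g K) : Realizes n c K := by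
  obtain ⟨e, he⟩ := h
  refine ⟨e.trans f.toEquiv, fun i j => ?_⟩
  rw [← he i j]
  exact f.map_adj_iff

theorem Realizes.nonempty_iso {V W : Type} {H : SimpleGraph V} {K : SimpleGraph W} {n c : ℕ}
    (h : Realizes n c H) (h' : Realizes n c K) : Nonempty (H ≃g K) := by
  obtain ⟨e, he⟩ := h
  obtain ⟨e', he'⟩ := h'
  refine ⟨⟨e.symm.trans e', fun {u v} => ?_⟩⟩
  obtain ⟨i, rfl⟩ := e.surjective u
  obtain ⟨j, rfl⟩ := e.surjective v
  simp only [Equiv.trans_apply, Equiv.symm_apply_apply]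
  rw [he, he']

/-- Choosing an ETS for each final code gives a map to structures, injective by the hash; the
structures with property `Q` are exactly the images of the codes that pass `P`. -/
theorem encard_structures {a : ℕ} (ha : a ≤ 9) (Q : ETSIn 4 8 → Prop) (P : ℕ → Bool)
    (hQ : ∀ s, Q s → ∃ c ∈ finalCodes a, Realizes a c (s.G.normalOn s.S))
    (hQP : ∀ s, ∀ c ∈ finalCodes a, Realizes a c (s.G.normalOn s.S) → (Q s ↔ P c = true)) :
    {q : ETSStructure 4 8 | ∃ s, Quotient.mk (ETSIn.setoid 4 8) s = q ∧ Q s}.encard =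
      ((finalCodes a).filter P).length := by
  have hnd := graphHash_nodup a (by omega)
  have hex : ∀ c ∈ finalCodes a, ∃ s : ETSIn 4 8, Realizes a c (s.G.normalOn s.S) := fun c hc =>
    have h := (finalCodes_table a (by omega)).1 c hc
    exists_etsIn h.1 h.2
  choose f hf using hex
  let F : {c // c ∈ finalCodes a} → ETSStructure 4 8 := fun c => Quotient.mk _ (f c c.2)
  have hF : Function.Injective F := by
    rintro ⟨c, hc⟩ ⟨d, hd⟩ h
    obtain ⟨φ⟩ := Quotient.exact h
    obtain ⟨ψ⟩ := TannerGraph.normalOn_iso_of_induced (f c hc).leftRegular (f d hd).leftRegular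
      (f c hc).isETS.1 (f d hd).isETS.1 φ
    exact Subtype.ext (List.inj_on_of_nodup_map hnd hc hd
      (graphHash_eq ((hf c hc).of_iso ψ) (hf d hd)))
  have himage : {q : ETSStructure 4 8 | ∃ s, Quotient.mk (ETSIn.setoid 4 8) s = q ∧ Q s} =
      F '' {c | P c = true} := by
    ext q
    constructor
    · rintro ⟨s, rfl, hs⟩
      obtain ⟨c, hc, hcs⟩ := hQ s hs
      refine ⟨⟨c, hc⟩, (hQP s c hc hcs).1 hs, Quotient.sound ?_⟩
      obtain ⟨φ⟩ := (hf c hc).nonempty_iso hcs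
      have := (f c hc).finR
      have := s.finR
      exact TannerGraph.induced_iso_of_normalOn (f c hc).leftRegular s.leftRegular
        (f c hc).isLinear s.isLinear (f c hc).isETS.1 s.isETS.1 φ
    · rintro ⟨⟨c, hc⟩, hP, rfl⟩
      exact ⟨f c hc, rfl, (hQP _ c hc (hf c hc)).2 hP⟩
  have hval : Subtype.val '' {c : {c // c ∈ finalCodes a} | P c = true} =
      (((finalCodes a).filter P).toFinset : Set ℕ) := by
    ext c
    simp [and_comm]
  rw [himage, hF.encard_image, ← Subtype.val_injective.encard_image, hval,
    Set.encard_coe_eq_coe_finsetCard, List.toFinset_card_of_nodup (hnd.of_map.filter _)]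

theorem encard_lssStructures {a b : ℕ} (ha : a ≤ 9) (hb : b ≤ 8) (x : ℕ) :
    (lssStructures 4 8 a b x).encard = ((finalCodes a).filter fun c =>
      codeDegSum a c + b == 4 * a && codeType a c == x).length :=
  encard_structures ha (fun s => s.G.IsTrappingSet s.S a b ∧ s.G.IsLSSType s.S x) _
    (fun s hs => s.exists_finalCode ha hb hs.1) fun s c hc hcs => by
      rw [ETSIn.isTrappingSet_iff hcs,
        ETSIn.isLSSType_iff hcs ((finalCodes_table a (by omega)).1 c hc).2]
      simp

theorem encard_lssAbsorbingStructures {a b : ℕ} (ha : a ≤ 9) (hb : b ≤ 8) (x : ℕ) :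
    (lssAbsorbingStructures 4 8 a b x).encard = ((finalCodes a).filter fun c =>
      codeDegSum a c + b == 4 * a && (codeAbsorbing a c && codeType a c == x)).length :=
  encard_structures ha
    (fun s => s.G.IsTrappingSet s.S a b ∧ s.G.IsLSSType s.S x ∧ s.G.IsAbsorbing s.S) _
    (fun s hs => s.exists_finalCode ha hb hs.1) fun s c hc hcs => by
      rw [ETSIn.isTrappingSet_iff hcs, ETSIn.isAbsorbing_iff hcs,
        ETSIn.isLSSType_iff hcs ((finalCodes_table a (by omega)).1 c hc).2]
      simp [and_comm]

theorem length_filter_eq_zero {a x : ℕ} (ha : a ≤ 9) (h8 : x ≠ 8) (h10 : x ≠ 10) (h12 : x ≠ 12)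
    {P : ℕ → Bool} (hP : ∀ c, P c = true → codeType a c = x) :
    ((finalCodes a).filter P).length = 0 := by
  rw [List.length_eq_zero_iff, List.filter_eq_nil_iff]
  intro c hc h
  have := hP c h
  rcases codeType_cases ((finalCodes_table a (by omega)).1 c hc).2 with h | h | h <;> omega

end LDPC

theorem mainTheorem6 :
    (∀ a b x : ℕ, a ≤ 9 → b ≤ 8 →
      (LDPC.lssStructures 4 8 a b x).encard = LDPC.tableTS a b x ∧
      (LDPC.lssAbsorbingStructures 4 8 a b x).encard = LDPC.tableAS a b x) ∧
    (∀ (s : LDPC.ETSIn 4 8) (a b : ℕ), a ≤ 9 → b ≤ 8 →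
      s.G.IsTrappingSet s.S a b → ∃ x : ℕ, s.G.IsLSSType s.S x) := by
  refine ⟨fun a b x ha hb => ?_, fun s a b ha hb h => ?_⟩
  · rw [LDPC.encard_lssStructures ha hb, LDPC.encard_lssAbsorbingStructures ha hb]
    by_cases hx : x ∈ [8, 10, 12]
    · obtain ⟨h1, h2⟩ := (LDPC.finalCodes_table a (by omega)).2 b (by omega) x hx
      rw [h1, h2]
      exact ⟨rfl, rfl⟩
    · simp only [List.mem_cons, List.not_mem_nil, or_false, not_or] at hx
      obtain ⟨h8, h10, h12⟩ := hx
      rw [LDPC.tableTS_eq_zero h8 h10 h12, LDPC.tableAS_eq_zero h8 h10 h12,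
        LDPC.length_filter_eq_zero ha h8 h10 h12 fun c hc => by simp_all,
        LDPC.length_filter_eq_zero ha h8 h10 h12 fun c hc => by simp_all]
      exact ⟨rfl, rfl⟩
  · obtain ⟨c, hc, hcs⟩ := s.exists_finalCode ha hb h
    exact ⟨_, (LDPC.ETSIn.isLSSType_iff hcs
      ((LDPC.finalCodes_table a (by omega)).1 c hc).2).2 rfl⟩
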